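/- For $k\in\mathbb{Z}$ let $\widetilde I_k=\{\xi\in\mathbb{R}: 2^{k-1}\le|\xi|\le 2^{k+1}\}$, and for $\xi\ne 0$, $\mu\in\mathbb{R}$ let $$\omega(\xi,\mu)=\xi^3+\mu^2/\xi,\qquad p(\xi,\mu)=1+\frac{|\mu|}{|\xi|+|\xi|^2}.$$ For $k\in\mathbb{Z}$ and $l,j\in\mathbb{R}$ let $D_{k,l,j}=\{(\xi,\mu,\tau)\in\mathbb{R}^3:\ \xi\in\widetilde I_k,\ |\mu|\le 2^l,\ |\tau-\omega(\xi,\mu)|\le 2^j\}$, and let $D_{k,\infty,j}=\bigcup_{l\in\mathbb{Z}}D_{k,l,j}$. There is an absolute constant $C>0$ such that the following holds for all $k_1,k_2,k\in\mathbb{Z}$, all integers $j_1,j_2,j\ge 0$, and all nonnegative functions $f_1,f_2\in L^2(\mathbb{R}^3)$ such that $f_i$ is supported in $D_{k_i,\infty,j_i}$ for $i=1,2$. (a) $$\|\mathbf 1_{D_{k,\infty,j}}\cdot(f_1\ast f_2)\|_{L^2}\le C\,2^{(j_1+j_2+j)/2}\,\big(2^{\max(j_1,j_2,j)}+2^{k_1+k_2+k}\big)^{-1/2}\,\|f_1\|_{L^2}\|f_2\|_{L^2}.$$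 (b) If $k_1\le 100$, then $$\|\mathbf 1_{D_{k,\infty,j}}\cdot(f_1\ast f_2)\|_{L^2}\le C\,2^{[k_1+\min(k_1,k_2,k)+\min(j_1,j_2,j)]/2}\,\|p(\xi_1,\mu_1)\, f_1\|_{L^2}\|f_2\|_{L^2},$$ and if $k_1\ge -100$, then $$\|\mathbf 1_{D_{k,\infty,j}}\cdot(f_1\ast f_2)\|_{L^2}\le C\,2^{[2k_1+\min(k_1,k_2,k)+\min(j_1,j_2,j)]/2}\,\|p(\xi_1,\mu_1)\, f_1\|_{L^2}\|f_2\|_{L^2}.$$ Here $p(\xi_1,\mu_1)f_1$ denotes the function $(\xi_1,\mu_1,\tau_1)\mapsto p(\xi_1,\mu_1)f_1(\xi_1,\mu_1,\tau_1)$, whose $L^2$ norm may be $+\infty$ (with $\infty\cdot 0=0$). -/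

import Mathlib

open MeasureTheory
open scoped Convolution ENNReal

noncomputable section

/-- The set of `ξ` with `|ξ| ∈ [2^(k-1), 2^(k+1)]`. -/
def dyadicShell (k : ℤ) : Set ℝ :=
  {ξ | (2 : ℝ) ^ (k - 1) ≤ |ξ| ∧ |ξ| ≤ (2 : ℝ) ^ (k + 1)}

/-- The dispersion relation `ω(ξ, μ) = ξ³ + μ²/ξ`; it is only used at `ξ ≠ 0`. -/
def kpOmega (ξ μ : ℝ) : ℝ := ξ ^ 3 + μ ^ 2 / ξ

/-- The weight `p(ξ, μ) = 1 + |μ| / (|ξ| + |ξ|²)`; it is only used at `ξ ≠ 0`. -/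
def kpWeight (ξ μ : ℝ) : ℝ := 1 + |μ| / (|ξ| + |ξ| ^ 2)

/-- `D_{k,l,j}`, a set of triples `(ξ, μ, τ)`. -/
def kpRegion (k : ℤ) (l j : ℝ) : Set (ℝ × ℝ × ℝ) :=
  {x | x.1 ∈ dyadicShell k ∧ |x.2.1| ≤ (2 : ℝ) ^ l ∧
    |x.2.2 - kpOmega x.1 x.2.1| ≤ (2 : ℝ) ^ j}

/-- `D_{k,∞,j}`, the union of the sets `D_{k,l,j}` over all integers `l`. -/
def kpRegionTop (k : ℤ) (j : ℝ) : Set (ℝ × ℝ × ℝ) :=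
  ⋃ l : ℤ, kpRegion k (l : ℝ) j

/-- `f` is a nonnegative square-integrable function on `ℝ³` that vanishes (almost everywhere)
outside `D`. -/
def IsNonnegL2SupportedIn (f : ℝ × ℝ × ℝ → ℝ) (D : Set (ℝ × ℝ × ℝ)) : Prop :=
  MemLp f 2 volume ∧ (∀ᵐ x, 0 ≤ f x) ∧ ∀ᵐ x, x ∉ D → f x = 0

/-- The `L²(ℝ³)` norm of `1_D · (f₁ ∗ f₂)`. -/
def restrictedConvNorm (D : Set (ℝ × ℝ × ℝ)) (f₁ f₂ : ℝ × ℝ × ℝ → ℝ) : ℝ≥0∞ :=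
  eLpNorm (D.indicator (f₁ ⋆[ContinuousLinearMap.mul ℝ ℝ, volume] f₂)) 2 volume

end

/-! By duality, the estimates are bounds for the form `∫∫ F₁(a) F₂(b) F₃(-(a+b))`. Since ω is odd,
the regions are invariant under negation, so the form treats its three arguments alike and the
largest modulation may be placed on the third.

For (a), the governing quantity is the resonance function Ω = ω(ξ₁,μ₁) + ω(ξ₂,μ₂) - ω(ξ₁+ξ₂,μ₁+μ₂) =
ξ₁ξ₂/(ξ₁+ξ₂) · P · Q, with P, Q = μ₁/ξ₁ - μ₂/ξ₂ ∓ √3(ξ₁+ξ₂). On the support of the form, |Ω| is at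
most three times 2^jmax. There are two regimes.

If 2^(k₁+k₂+k) is not much larger than 2^jmax, the L⁴ Strichartz bound
`lintegral_sq_lconv_le_of_modulation` suffices. It rests on `volume_kpPhase_le`: after completing
the square in μ, the slices of a sublevel set of the phase have length at most a multiple of (R -
t²)^(-1/2), whose integral in t does not depend on R.

Otherwise P and Q cannot both be small, because their difference is 2√3(ξ₁+ξ₂); hence one of them is
at most R ~ 2^(jmax-k₁-k₂) (`abs_kpSlope_sub_le_or`). The plane (ξ, μ) is foliated by the parabolas
μ = ±√3 ξ² + βξ, with opposite signs for the two factors, so that the small quantity is the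
difference of the two labels β. With the label and the modulation of the first factor fixed, a
change of variables to the sum of the frequencies gains 1/|ξ₁+ξ₂| (`lintegral_resonantRegion_le`);
integration over the labels, which differ by at most R, gains R (`sq_lintegral_resonant_le`). The
product of the gains is 2^(jmax-k₁-k₂-k).

For (b), the integrals in τ, μ and ξ are estimated in turn: the shortest τ-interval, then the
inverse square of the weight, whose μ-integral is at most π(|ξ₁|+|ξ₁|²), then the shortest
ξ-interval (`sq_trilinearForm_le_weighted`). -/

/-! ### Cauchy–Schwarz, square roots and squares in `ℝ≥0∞` -/

/-- The Cauchy–Schwarz inequality for lower Lebesgue integrals, in squared form. -/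
theorem sq_lintegral_mul_le {α : Type*} [MeasurableSpace α] {μ : Measure α}
    {f g : α → ℝ≥0∞} (hf : AEMeasurable f μ) (hg : AEMeasurable g μ) :
    (∫⁻ x, f x * g x ∂μ) ^ 2 ≤ (∫⁻ x, f x ^ 2 ∂μ) * ∫⁻ x, g x ^ 2 ∂μ := by
  have h := ENNReal.lintegral_mul_le_Lp_mul_Lq μ Real.HolderConjugate.two_two hf hg
  simp only [ENNReal.rpow_ofNat, Pi.mul_apply] at h
  calc _ ≤ _ := pow_le_pow_left' h 2
    _ = _ := by
      rw [mul_pow, ← ENNReal.rpow_natCast, ← ENNReal.rpow_natCast, ← ENNReal.rpow_mul,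
        ← ENNReal.rpow_mul]
      norm_num

theorem ENNReal.sqrt_sq (x : ℝ≥0∞) : (x ^ (1 / 2 : ℝ)) ^ 2 = x := by
  rw [← ENNReal.rpow_natCast, ← ENNReal.rpow_mul]; norm_num

theorem ENNReal.sq_sqrt (x : ℝ≥0∞) : (x ^ 2) ^ (1 / 2 : ℝ) = x := by
  rw [← ENNReal.rpow_natCast, ← ENNReal.rpow_mul]; norm_num

theorem ENNReal.le_sqrt_of_sq_le {x y : ℝ≥0∞} (h : x ^ 2 ≤ y) : x ≤ y ^ (1 / 2 : ℝ) := by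
  rw [← ENNReal.sq_sqrt x]
  exact ENNReal.rpow_le_rpow h (by norm_num)

theorem ENNReal.le_of_sq_le_mul_self {x y : ℝ≥0∞} (hx : x ≠ ∞) (h : x ^ 2 ≤ y * x) : x ≤ y := by
  rcases eq_or_ne x 0 with rfl | h0
  · exact zero_le
  · rw [sq] at h
    exact (ENNReal.mul_le_mul_iff_left h0 hx).1 h

theorem ENNReal.add_sq_le (x y : ℝ≥0∞) : (x + y) ^ 2 ≤ 2 * x ^ 2 + 2 * y ^ 2 := by
  have := ENNReal.rpow_add_le_mul_rpow_add_rpow x y (p := 2) (by norm_num)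
  norm_num [mul_add] at this
  exact this

/-! ### The trilinear form and convolution on an abelian group -/

/-- `∫∫ F₁(a) F₂(b) F₃(-(a+b)) da db`, a form symmetric in its three arguments. -/
noncomputable def trilinearForm {α : Type*} [MeasureSpace α] [AddCommGroup α]
    (F₁ F₂ F₃ : α → ℝ≥0∞) : ℝ≥0∞ :=
  ∫⁻ a, ∫⁻ b, F₁ a * F₂ b * F₃ (-(a + b))

/-- Convolution of nonnegative functions. -/
noncomputable def lconv {α : Type*} [MeasureSpace α] [AddCommGroup α]
    (F₁ F₂ : α → ℝ≥0∞) (x : α) : ℝ≥0∞ :=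
  ∫⁻ t, F₁ t * F₂ (x - t)

set_option linter.unusedSectionVars false

section Trilinear

variable {α : Type*} [MeasureSpace α] [AddCommGroup α] [MeasurableAdd₂ α] [MeasurableNeg α]
  [SFinite (volume : Measure α)] [(volume : Measure α).IsAddLeftInvariant]
  [(volume : Measure α).IsNegInvariant] {F₁ F₂ F₃ : α → ℝ≥0∞}

theorem trilinearForm_swap_left (h₁ : Measurable F₁) (h₂ : Measurable F₂) (h₃ : Measurable F₃) :
    trilinearForm F₁ F₂ F₃ = trilinearForm F₂ F₁ F₃ := by
  unfold trilinearForm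
  rw [lintegral_lintegral_swap (by fun_prop)]
  refine lintegral_congr fun a => lintegral_congr fun b => ?_
  rw [mul_comm (F₁ b), add_comm b]

theorem trilinearForm_swap_right (F₁ F₂ F₃ : α → ℝ≥0∞) :
    trilinearForm F₁ F₂ F₃ = trilinearForm F₁ F₃ F₂ := by
  unfold trilinearForm
  refine lintegral_congr fun a => ?_
  rw [← lintegral_sub_left_eq_self (fun b => F₁ a * F₃ b * F₂ (-(a + b))) (-a)]
  refine lintegral_congr fun b => ?_
  rw [show -(a + (-a - b)) = b by abel, show -a - b = -(a + b) by abel]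
  ring

theorem measurable_lconv (h₁ : Measurable F₁) (h₂ : Measurable F₂) : Measurable (lconv F₁ F₂) := by
  unfold lconv
  have : Measurable fun p : α × α => F₁ p.2 * F₂ (p.1 - p.2) := by
    simp only [sub_eq_add_neg]; fun_prop
  exact this.lintegral_prod_right'

theorem trilinearForm_eq_lintegral_lconv (h₁ : Measurable F₁) (h₂ : Measurable F₂)
    (h₃ : Measurable F₃) :
    trilinearForm F₁ F₂ F₃ = ∫⁻ x, lconv F₁ F₂ x * F₃ (-x) := by
  unfold trilinearForm lconv
  have hm : Measurable fun p : α × α => F₁ p.2 * F₂ (p.1 - p.2) := by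
    simp only [sub_eq_add_neg]; fun_prop
  calc _ = ∫⁻ a, ∫⁻ x, F₁ a * F₂ (x - a) * F₃ (-x) := by
        refine lintegral_congr fun a => ?_
        rw [← lintegral_add_left_eq_self (fun x => F₁ a * F₂ (x - a) * F₃ (-x)) a]
        simp
    _ = ∫⁻ x, ∫⁻ a, F₁ a * F₂ (x - a) * F₃ (-x) := by
        rw [lintegral_lintegral_swap]
        simp only [sub_eq_add_neg]; fun_prop
    _ = _ := by
        refine lintegral_congr fun x => ?_
        rw [lintegral_mul_const]
        simp only [sub_eq_add_neg]; fun_prop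

theorem sq_trilinearForm_le_lconv (h₁ : Measurable F₁) (h₂ : Measurable F₂)
    (h₃ : Measurable F₃) :
    trilinearForm F₁ F₂ F₃ ^ 2 ≤ (∫⁻ x, lconv F₁ F₂ x ^ 2) * ∫⁻ x, F₃ x ^ 2 := by
  rw [trilinearForm_eq_lintegral_lconv h₁ h₂ h₃, ← lintegral_neg_eq_self (fun x => F₃ x ^ 2)]
  exact sq_lintegral_mul_le (measurable_lconv h₁ h₂).aemeasurable (by fun_prop)

theorem lconv_comm (F₁ F₂ : α → ℝ≥0∞) : lconv F₁ F₂ = lconv F₂ F₁ := by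
  ext x
  unfold lconv
  rw [← lintegral_sub_left_eq_self _ x]
  refine lintegral_congr fun t => ?_
  rw [sub_sub_cancel, mul_comm]

/-- Opening the square and putting `b = x - t` pairs the autocorrelations of `F₁` and `F₂` at the
same shift `t - s`. Reflecting `F₂` only changes the sign of its shift, and exchanging `s` and `t`
undoes that; this is how the next lemma follows. -/
theorem lintegral_sq_lconv (h₁ : Measurable F₁) (h₂ : Measurable F₂) :
    ∫⁻ x, lconv F₁ F₂ x ^ 2 =
      ∫⁻ s, ∫⁻ t, ∫⁻ b, F₁ s * F₁ t * F₂ b * F₂ (t - s + b) := by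
  have hm : ∀ x, Measurable fun t => F₁ t * F₂ (x - t) := fun x => by
    simp only [sub_eq_add_neg]; fun_prop
  calc _ = ∫⁻ x, ∫⁻ s, ∫⁻ t, F₁ s * F₂ (x - s) * (F₁ t * F₂ (x - t)) := by
        refine lintegral_congr fun x => ?_
        rw [sq]
        unfold lconv
        rw [← lintegral_mul_const _ (hm x)]
        refine lintegral_congr fun s => ?_
        rw [lintegral_const_mul _ (hm x)]
    _ = ∫⁻ s, ∫⁻ x, ∫⁻ t, F₁ s * F₂ (x - s) * (F₁ t * F₂ (x - t)) := by
        rw [lintegral_lintegral_swap]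
        have : Measurable fun p : (α × α) × α =>
            F₁ p.1.2 * F₂ (p.1.1 - p.1.2) * (F₁ p.2 * F₂ (p.1.1 - p.2)) := by
          simp only [sub_eq_add_neg]; fun_prop
        exact this.lintegral_prod_right'.aemeasurable
    _ = ∫⁻ s, ∫⁻ t, ∫⁻ x, F₁ s * F₂ (x - s) * (F₁ t * F₂ (x - t)) := by
        refine lintegral_congr fun s => ?_
        rw [lintegral_lintegral_swap]
        simp only [sub_eq_add_neg]; fun_prop
    _ = _ := by
        refine lintegral_congr fun s => lintegral_congr fun t => ?_
        rw [← lintegral_add_left_eq_self _ t]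
        refine lintegral_congr fun b => ?_
        rw [add_sub_cancel_left, add_sub_right_comm]
        ring

/-- The frequency-side form of `‖u₁ u₂‖₂ = ‖u₁ ū₂‖₂`. -/
theorem lintegral_sq_lconv_reflect (h₁ : Measurable F₁) (h₂ : Measurable F₂) :
    ∫⁻ x, lconv F₁ (fun y => F₂ (-y)) x ^ 2 = ∫⁻ x, lconv F₁ F₂ x ^ 2 := by
  rw [lintegral_sq_lconv h₁ h₂, lintegral_sq_lconv h₁ (by fun_prop), lintegral_lintegral_swap]
  · refine lintegral_congr fun s => lintegral_congr fun t => ?_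
    rw [← lintegral_neg_eq_self]
    refine lintegral_congr fun b => ?_
    rw [neg_neg, show -(s - t + -b) = t - s + b by abel, mul_comm (F₁ t)]
  · have : Measurable fun p : (α × α) × α =>
        F₁ p.1.1 * F₁ p.1.2 * F₂ (-p.2) * F₂ (-(p.1.2 - p.1.1 + p.2)) := by
      simp only [sub_eq_add_neg]; fun_prop
    exact this.lintegral_prod_right'.aemeasurable

/-- Cauchy–Schwarz in `t` on each fibre `E x` costs the factor `volume (E x)`; what remains is a
convolution of squares, which factors by Tonelli. -/
theorem lintegral_sq_lconv_le_of_fiber (h₁ : Measurable F₁) (h₂ : Measurable F₂) {M : ℝ≥0∞}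
    {E : α → Set α} (hE : ∀ x, MeasurableSet (E x))
    (hsupp : ∀ x t, F₁ t * F₂ (x - t) ≠ 0 → t ∈ E x) (hM : ∀ x, volume (E x) ≤ M) :
    ∫⁻ x, lconv F₁ F₂ x ^ 2 ≤ M * (∫⁻ x, F₁ x ^ 2) * ∫⁻ x, F₂ x ^ 2 := by
  have hm : Measurable fun p : α × α => F₁ p.2 ^ 2 * F₂ (p.1 - p.2) ^ 2 := by
    simp only [sub_eq_add_neg]; fun_prop
  have hm' : ∀ x, Measurable fun t => F₁ t * F₂ (x - t) := fun x => by
    simp only [sub_eq_add_neg]; fun_prop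
  calc _ ≤ ∫⁻ x, M * ∫⁻ t, F₁ t ^ 2 * F₂ (x - t) ^ 2 := by
        refine lintegral_mono fun x => ?_
        have : lconv F₁ F₂ x = ∫⁻ t, (E x).indicator 1 t * (F₁ t * F₂ (x - t)) := by
          refine lintegral_congr fun t => ?_
          by_cases h : t ∈ E x
          · simp [h]
          · simp [h, not_not.1 (mt (hsupp x t) h)]
        rw [this]
        refine (sq_lintegral_mul_le ((measurable_one.indicator (hE x)).aemeasurable)
          (hm' x).aemeasurable).trans ?_
        simp only [mul_pow]
        gcongr
        refine le_trans (le_of_eq ?_) (hM x)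
        rw [← lintegral_indicator_one (hE x)]
        refine lintegral_congr fun t => ?_
        by_cases h : t ∈ E x <;> simp [h]
    _ = M * ∫⁻ t, ∫⁻ x, F₁ t ^ 2 * F₂ (x - t) ^ 2 := by
        rw [lintegral_const_mul _ hm.lintegral_prod_right', lintegral_lintegral_swap hm.aemeasurable]
    _ = _ := by
        rw [mul_assoc, ← lintegral_mul_const _ (by fun_prop)]
        congr 1
        refine lintegral_congr fun t => ?_
        rw [← lintegral_add_left_eq_self _ t, ← lintegral_const_mul _ (by fun_prop)]
        simp

/-- Duality: bounds on the trilinear form control the restricted convolution. -/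
theorem lintegral_sq_lconv_le_of_dual (h₁ : Measurable F₁) (h₂ : Measurable F₂) {K : ℝ≥0∞}
    {D : Set α} (hD : MeasurableSet D) (hDneg : ∀ x, -x ∈ D → x ∈ D)
    (hfin : ∫⁻ x, lconv F₁ F₂ x ^ 2 ≠ ∞)
    (hK : ∀ F₃ : α → ℝ≥0∞, Measurable F₃ → (∀ x, F₃ x ≠ 0 → x ∈ D) →
      trilinearForm F₁ F₂ F₃ ^ 2 ≤ K * ∫⁻ x, F₃ x ^ 2) :
    ∫⁻ x, D.indicator (lconv F₁ F₂) x ^ 2 ≤ K := by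
  have hm := (measurable_lconv h₁ h₂).indicator hD
  -- The test function is the reflected restricted convolution itself, so the form equals its
  -- squared norm `N` and the bound reads `N² ≤ K N`. Dividing by `N` is legitimate because `hfin`
  -- makes it finite.
  have key := hK (fun x => D.indicator (lconv F₁ F₂) (-x)) (by fun_prop) (fun x hx => by
    apply hDneg
    by_contra h
    simp [h] at hx)
  rw [trilinearForm_eq_lintegral_lconv h₁ h₂ (by fun_prop),
    lintegral_neg_eq_self (fun x => D.indicator (lconv F₁ F₂) x ^ 2)] at key
  refine ENNReal.le_of_sq_le_mul_self (ne_top_of_le_ne_top hfin ?_) ?_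
  · refine lintegral_mono fun x => ?_
    by_cases h : x ∈ D <;> simp [h]
  · refine le_trans (le_of_eq ?_) key
    congr 1
    refine lintegral_congr fun x => ?_
    by_cases h : x ∈ D <;> simp [h, sq]

/-- Young's inequality in trilinear form. -/
theorem sq_trilinearForm_le_lintegral (h₁ : Measurable F₁) (h₂ : Measurable F₂)
    (h₃ : Measurable F₃) :
    trilinearForm F₁ F₂ F₃ ^ 2 ≤ (∫⁻ x, F₁ x) ^ 2 * (∫⁻ x, F₂ x ^ 2) * ∫⁻ x, F₃ x ^ 2 := by
  have key : trilinearForm F₁ F₂ F₃ ≤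
      (∫⁻ a, F₁ a) * ((∫⁻ x, F₂ x ^ 2) * ∫⁻ x, F₃ x ^ 2) ^ (1 / 2 : ℝ) := by
    unfold trilinearForm
    rw [← lintegral_mul_const _ h₁]
    refine lintegral_mono fun a => ?_
    simp only [mul_assoc]
    rw [lintegral_const_mul _ (by fun_prop)]
    gcongr
    refine ENNReal.le_sqrt_of_sq_le ((sq_lintegral_mul_le (by fun_prop) (by fun_prop)).trans ?_)
    refine mul_le_mul_right ?_ _
    rw [← lintegral_sub_left_eq_self (fun x => F₃ x ^ 2) (-a)]
    refine lintegral_mono fun b => ?_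
    rw [show -a - b = -(a + b) by abel]
  calc _ ≤ _ := pow_le_pow_left' key 2
    _ = _ := by rw [mul_pow, ENNReal.sqrt_sq, mul_assoc]

theorem sq_lintegral_le_of_support (h₁ : Measurable F₁) {S : Set α} (hS : MeasurableSet S)
    (hsupp : ∀ x, F₁ x ≠ 0 → x ∈ S) : (∫⁻ x, F₁ x) ^ 2 ≤ volume S * ∫⁻ x, F₁ x ^ 2 := by
  have : ∫⁻ x, F₁ x = ∫⁻ x, S.indicator 1 x * F₁ x := by
    refine lintegral_congr fun x => ?_
    by_cases h : x ∈ S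
    · simp [h]
    · simp [h, not_not.1 (mt (hsupp x) h)]
  rw [this]
  refine (sq_lintegral_mul_le (measurable_one.indicator hS).aemeasurable
    h₁.aemeasurable).trans ?_
  gcongr
  rw [← lintegral_indicator_one hS]
  refine lintegral_mono fun t => ?_
  by_cases h : t ∈ S <;> simp [h]

theorem sq_trilinearForm_le_of_support (h₁ : Measurable F₁) (h₂ : Measurable F₂)
    (h₃ : Measurable F₃) {S : Set α} (hS : MeasurableSet S) (hsupp : ∀ x, F₁ x ≠ 0 → x ∈ S) :
    trilinearForm F₁ F₂ F₃ ^ 2 ≤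
      volume S * (∫⁻ x, F₁ x ^ 2) * (∫⁻ x, F₂ x ^ 2) * ∫⁻ x, F₃ x ^ 2 := by
  refine (sq_trilinearForm_le_lintegral h₁ h₂ h₃).trans ?_
  gcongr
  exact sq_lintegral_le_of_support h₁ hS hsupp

/-- The smallest of the three supports may be used. -/
theorem sq_trilinearForm_le_min_support (h₁ : Measurable F₁) (h₂ : Measurable F₂)
    (h₃ : Measurable F₃) {S₁ S₂ S₃ : Set α} (hS₁ : MeasurableSet S₁) (hS₂ : MeasurableSet S₂)
    (hS₃ : MeasurableSet S₃) (hsupp₁ : ∀ x, F₁ x ≠ 0 → x ∈ S₁) (hsupp₂ : ∀ x, F₂ x ≠ 0 → x ∈ S₂)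
    (hsupp₃ : ∀ x, F₃ x ≠ 0 → x ∈ S₃) :
    trilinearForm F₁ F₂ F₃ ^ 2 ≤ min (volume S₁) (min (volume S₂) (volume S₃)) *
      (∫⁻ x, F₁ x ^ 2) * (∫⁻ x, F₂ x ^ 2) * ∫⁻ x, F₃ x ^ 2 := by
  rcases min_choice (volume S₁) (min (volume S₂) (volume S₃)) with h | h <;> rw [h]
  · exact sq_trilinearForm_le_of_support h₁ h₂ h₃ hS₁ hsupp₁
  rcases min_choice (volume S₂) (volume S₃) with h | h <;> rw [h]
  · rw [trilinearForm_swap_left h₁ h₂ h₃]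
    exact (sq_trilinearForm_le_of_support h₂ h₁ h₃ hS₂ hsupp₂).trans_eq (by ring)
  · rw [trilinearForm_swap_right, trilinearForm_swap_left h₁ h₃ h₂]
    exact (sq_trilinearForm_le_of_support h₃ h₁ h₂ hS₃ hsupp₃).trans_eq (by ring)

end Trilinear

/-! ### Reduction of the form on a product to its factors -/

section Product

variable {α β : Type*} [MeasureSpace α] [AddCommGroup α] [MeasurableAdd₂ α] [MeasurableNeg α]
  [SFinite (volume : Measure α)] [MeasureSpace β] [AddCommGroup β] [MeasurableAdd₂ β]
  [MeasurableNeg β] [SFinite (volume : Measure β)]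

theorem trilinearForm_prod {F₁ F₂ F₃ : α × β → ℝ≥0∞} (h₁ : Measurable F₁) (h₂ : Measurable F₂)
    (h₃ : Measurable F₃) :
    trilinearForm F₁ F₂ F₃ = ∫⁻ a, ∫⁻ a', trilinearForm (fun b => F₁ (a, b))
      (fun b => F₂ (a', b)) (fun b => F₃ (-(a + a'), b)) := by
  unfold trilinearForm
  have hm : Measurable fun p : (α × β) × (α × β) => F₁ p.1 * F₂ p.2 *
      F₃ (-(p.1.1 + p.2.1), -(p.1.2 + p.2.2)) := by
    fun_prop
  refine (lintegral_prod _ hm.lintegral_prod_right'.aemeasurable).trans ?_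
  refine lintegral_congr fun a => ?_
  calc _ = ∫⁻ b, ∫⁻ a', ∫⁻ b', F₁ (a, b) * F₂ (a', b') * F₃ (-((a, b) + (a', b'))) := by
        refine lintegral_congr fun b => ?_
        exact lintegral_prod _ (hm.comp measurable_prodMk_left).aemeasurable
    _ = _ := by
        rw [lintegral_lintegral_swap]
        · rfl
        · have : Measurable fun p : (β × α) × β =>
            F₁ (a, p.1.1) * F₂ (p.1.2, p.2) * F₃ (-(a + p.1.2), -(p.1.1 + p.2)) := by
            fun_prop
          exact this.lintegral_prod_right'.aemeasurable

/-- A bound for the slices reduces the form on a product to a form on the first factor. -/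
theorem trilinearForm_prod_le {F₁ F₂ F₃ : α × β → ℝ≥0∞} (h₁ : Measurable F₁)
    (h₂ : Measurable F₂) (h₃ : Measurable F₃) {M : α → ℝ≥0∞} (hM : Measurable M) {K : ℝ≥0∞}
    (hK : ∀ a a', trilinearForm (fun b => F₁ (a, b)) (fun b => F₂ (a', b))
        (fun b => F₃ (-(a + a'), b)) ^ 2 ≤
      K * M a * (∫⁻ b, F₂ (a', b) ^ 2) * ∫⁻ b, F₃ (-(a + a'), b) ^ 2) :
    trilinearForm F₁ F₂ F₃ ^ 2 ≤ K * trilinearForm (fun a => M a ^ (1 / 2 : ℝ))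
      (fun a => (∫⁻ b, F₂ (a, b) ^ 2) ^ (1 / 2 : ℝ))
      (fun a => (∫⁻ b, F₃ (a, b) ^ 2) ^ (1 / 2 : ℝ)) ^ 2 := by
  have hm₂ : Measurable fun a => ∫⁻ b, F₂ (a, b) ^ 2 := (h₂.pow_const 2).lintegral_prod_right'
  have hm₃ : Measurable fun a => ∫⁻ b, F₃ (a, b) ^ 2 := (h₃.pow_const 2).lintegral_prod_right'
  have key : trilinearForm F₁ F₂ F₃ ≤ K ^ (1 / 2 : ℝ) *
      trilinearForm (fun a => M a ^ (1 / 2 : ℝ))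
      (fun a => (∫⁻ b, F₂ (a, b) ^ 2) ^ (1 / 2 : ℝ))
      (fun a => (∫⁻ b, F₃ (a, b) ^ 2) ^ (1 / 2 : ℝ)) := by
    have hm : Measurable fun p : α × α => M p.1 ^ (1 / 2 : ℝ) *
        (∫⁻ b, F₂ (p.2, b) ^ 2) ^ (1 / 2 : ℝ) *
        (∫⁻ b, F₃ (-(p.1 + p.2), b) ^ 2) ^ (1 / 2 : ℝ) := by
      have e₂ : Measurable fun p : α × α => ∫⁻ b, F₂ (p.2, b) ^ 2 := hm₂.comp measurable_snd
      have e₃ : Measurable fun p : α × α => ∫⁻ b, F₃ (-(p.1 + p.2), b) ^ 2 :=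
        hm₃.comp (by fun_prop : Measurable fun p : α × α => -(p.1 + p.2))
      fun_prop
    rw [trilinearForm_prod h₁ h₂ h₃]
    unfold trilinearForm at hK ⊢
    rw [← lintegral_const_mul _ hm.lintegral_prod_right']
    refine lintegral_mono fun a => ?_
    refine le_of_le_of_eq ?_
      (lintegral_const_mul (K ^ (1 / 2 : ℝ)) (hm.comp (measurable_prodMk_left (x := a))))
    refine lintegral_mono fun a' => ?_
    refine (ENNReal.le_sqrt_of_sq_le (hK a a')).trans_eq ?_
    simp only [ENNReal.mul_rpow_of_nonneg _ _ (by norm_num : (0 : ℝ) ≤ 1 / 2), mul_assoc]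
  calc _ ≤ _ := pow_le_pow_left' key 2
    _ = _ := by rw [mul_pow, ENNReal.sqrt_sq]

end Product

/-! ### The dispersion relation, the regions and the weight -/

theorem lintegral_comp_affine {c : ℝ} (hc : c ≠ 0) (d : ℝ) (g : ℝ → ℝ≥0∞) :
    ∫⁻ x, g x = ∫⁻ y, ENNReal.ofReal |c| * g (c * y + d) := by
  have h := lintegral_image_eq_lintegral_abs_deriv_mul (s := Set.univ) (f := fun y => c * y + d)
    (f' := fun _ => c) MeasurableSet.univ
    (fun x _ => by
      simpa using (((hasDerivAt_id x).const_mul c).add_const d).hasDerivWithinAt (s := Set.univ))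
    (fun x _ y _ hxy => by simpa [hc] using hxy) g
  have hs : (fun y => c * y + d) '' Set.univ = Set.univ := by
    rw [Set.image_univ]
    refine Set.eq_univ_of_forall fun y => ⟨(y - d) / c, ?_⟩
    field_simp
    ring
  rwa [hs, setLIntegral_univ, setLIntegral_univ] at h

theorem mem_kpRegionTop_iff {k : ℤ} {j : ℕ} {x : ℝ × ℝ × ℝ} :
    x ∈ kpRegionTop k j ↔
      x.1 ∈ dyadicShell k ∧ |x.2.2 - kpOmega x.1 x.2.1| ≤ (2 : ℝ) ^ j := by
  simp only [kpRegionTop, kpRegion, Set.mem_iUnion, Set.mem_ofPred_eq, Real.rpow_natCast,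
    Real.rpow_intCast]
  refine ⟨fun ⟨l, h⟩ => ⟨h.1, h.2.2⟩, fun h => ?_⟩
  obtain ⟨n, hn⟩ := pow_unbounded_of_one_lt |x.2.1| (by norm_num : (1 : ℝ) < 2)
  exact ⟨n, h.1, by exact_mod_cast hn.le, h.2⟩

theorem kpOmega_neg (ξ μ : ℝ) : kpOmega (-ξ) (-μ) = -kpOmega ξ μ := by
  unfold kpOmega
  rw [neg_sq, div_neg]
  ring

theorem neg_mem_kpRegionTop {k : ℤ} {j : ℕ} {x : ℝ × ℝ × ℝ} (h : -x ∈ kpRegionTop k j) :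
    x ∈ kpRegionTop k j := by
  rw [mem_kpRegionTop_iff] at h ⊢
  simp only [dyadicShell, Prod.fst_neg, Prod.snd_neg, Set.mem_ofPred_eq, abs_neg, kpOmega_neg,
    neg_sub_neg] at h
  rw [abs_sub_comm] at h
  exact h

theorem measurable_kpOmega : Measurable fun x : ℝ × ℝ => kpOmega x.1 x.2 := by
  unfold kpOmega
  fun_prop

theorem measurable_kpWeight : Measurable fun x : ℝ × ℝ × ℝ => kpWeight x.1 x.2.1 := by
  unfold kpWeight
  fun_prop

theorem measurableSet_dyadicShell (k : ℤ) : MeasurableSet (dyadicShell k) := by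
  have : dyadicShell k = {ξ | (2 : ℝ) ^ (k - 1) ≤ |ξ|} ∩ {ξ | |ξ| ≤ (2 : ℝ) ^ (k + 1)} := rfl
  rw [this]
  exact (measurableSet_le measurable_const (by fun_prop)).inter
    (measurableSet_le (by fun_prop) measurable_const)

theorem measurableSet_kpRegionTop (k : ℤ) (j : ℕ) : MeasurableSet (kpRegionTop k j) := by
  have : kpRegionTop k j =
      Prod.fst ⁻¹' dyadicShell k ∩ {x | |x.2.2 - kpOmega x.1 x.2.1| ≤ (2 : ℝ) ^ j} :=
    Set.ext fun x => mem_kpRegionTop_iff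
  rw [this]
  have h : Measurable fun x : ℝ × ℝ × ℝ => kpOmega x.1 x.2.1 :=
    measurable_kpOmega.comp (by fun_prop : Measurable fun x : ℝ × ℝ × ℝ => (x.1, x.2.1))
  refine (measurable_fst (measurableSet_dyadicShell k)).inter
    (measurableSet_le ?_ measurable_const)
  exact (measurable_snd.snd.sub h).abs

theorem pos_of_mem_dyadicShell {k : ℤ} {ξ : ℝ} (h : ξ ∈ dyadicShell k) : 0 < |ξ| :=
  lt_of_lt_of_le (by positivity) h.1

theorem one_le_kpWeight (ξ μ : ℝ) : 1 ≤ kpWeight ξ μ := by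
  unfold kpWeight
  have : 0 ≤ |μ| / (|ξ| + |ξ| ^ 2) := by positivity
  linarith

theorem lintegral_inv_one_add_sq : ∫⁻ x : ℝ, ENNReal.ofReal (1 + x ^ 2)⁻¹ = ENNReal.ofReal Real.pi := by
  rw [← ofReal_integral_eq_lintegral_ofReal integrable_inv_one_add_sq
    (Filter.Eventually.of_forall fun x => by positivity), integral_univ_inv_one_add_sq]

/-- Scaling `μ = A y` with `A = |ξ| + |ξ|²` turns the weight into `1 + |y|`, and `(1 + |y|)² ≥ 1 +
y²` leaves the integral of `1 / (1 + y²)`. The factor `A` is the source of the powers of `2 ^ k₁` in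
the weighted estimates. -/
theorem lintegral_inv_kpWeight_sq_le {ξ : ℝ} (hξ : 0 < |ξ|) :
    ∫⁻ μ, ENNReal.ofReal (kpWeight ξ μ)⁻¹ ^ 2 ≤ ENNReal.ofReal (Real.pi * (|ξ| + |ξ| ^ 2)) := by
  set A := |ξ| + |ξ| ^ 2 with hA
  have hA0 : 0 < A := by positivity
  rw [lintegral_comp_affine hA0.ne' 0, abs_of_pos hA0]
  calc _ ≤ ∫⁻ y : ℝ, ENNReal.ofReal A * ENNReal.ofReal (1 + y ^ 2)⁻¹ := by
        refine lintegral_mono fun y => ?_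
        gcongr
        rw [← ENNReal.ofReal_pow (by have := one_le_kpWeight ξ (A * y + 0); positivity)]
        refine ENNReal.ofReal_le_ofReal ?_
        have : kpWeight ξ (A * y + 0) = 1 + |y| := by
          unfold kpWeight
          rw [add_zero, abs_mul, abs_of_pos hA0, ← hA]
          field_simp
        rw [this, inv_pow]
        gcongr
        nlinarith [abs_nonneg y, sq_abs y]
    _ = _ := by
        rw [lintegral_const_mul' _ _ ENNReal.ofReal_ne_top, lintegral_inv_one_add_sq,
          ← ENNReal.ofReal_mul hA0.le, mul_comm]

/-! ### The weighted trilinear estimate -/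

/-- Bilinear estimate by sizes of supports, with the `μ`-integral paid for by the weight. -/
theorem sq_trilinearForm_le_weighted {k₁ k₂ k₃ : ℤ} {j₁ j₂ j₃ : ℕ}
    {F₁ F₂ F₃ : ℝ × ℝ × ℝ → ℝ≥0∞} (h₁ : Measurable F₁) (h₂ : Measurable F₂) (h₃ : Measurable F₃)
    (s₁ : ∀ x, F₁ x ≠ 0 → x ∈ kpRegionTop k₁ j₁) (s₂ : ∀ x, F₂ x ≠ 0 → x ∈ kpRegionTop k₂ j₂)
    (s₃ : ∀ x, F₃ x ≠ 0 → x ∈ kpRegionTop k₃ j₃) {A : ℝ}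
    (hA : ∀ ξ ∈ dyadicShell k₁, |ξ| + |ξ| ^ 2 ≤ A) :
    trilinearForm F₁ F₂ F₃ ^ 2 ≤
      ENNReal.ofReal (2 * 2 ^ min j₁ (min j₂ j₃)) * ENNReal.ofReal (Real.pi * A) *
        ENNReal.ofReal (4 * 2 ^ min k₁ (min k₂ k₃)) *
        (∫⁻ x, (ENNReal.ofReal (kpWeight x.1 x.2.1) * F₁ x) ^ 2) * (∫⁻ x, F₂ x ^ 2) *
          ∫⁻ x, F₃ x ^ 2 := by
  simp only [mem_kpRegionTop_iff] at s₁ s₂ s₃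
  set Kτ : ℝ≥0∞ := ENNReal.ofReal (2 * 2 ^ min j₁ (min j₂ j₃)) with hKτ
  have hmonoj : Monotone fun j : ℕ => ENNReal.ofReal (2 * 2 ^ j) := fun a b hab =>
    ENNReal.ofReal_le_ofReal
      (mul_le_mul_of_nonneg_left (pow_le_pow_right₀ (by norm_num) hab) (by norm_num))
  have hmonok : Monotone fun k : ℤ => ENNReal.ofReal (4 * 2 ^ k) := fun a b hab =>
    ENNReal.ofReal_le_ofReal
      (mul_le_mul_of_nonneg_left (zpow_le_zpow_right₀ (by norm_num) hab) (by norm_num))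
  have hvolτ : ∀ (c : ℝ) (j : ℕ), volume (Set.Icc (c - 2 ^ j) (c + 2 ^ j)) =
      ENNReal.ofReal (2 * 2 ^ j) := fun c j => by
    rw [Real.volume_Icc]; congr 1; ring
  have hvolξ : ∀ k : ℤ, volume (Set.Icc (-(2 : ℝ) ^ (k + 1)) (2 ^ (k + 1))) =
      ENNReal.ofReal (4 * 2 ^ k) := fun k => by
    rw [Real.volume_Icc, zpow_add_one₀ (by norm_num)]; congr 1; ring
  -- the `τ`-integrals
  have Hτ : ∀ ξ ξ' μ μ', trilinearForm (fun τ => F₁ (ξ, μ, τ)) (fun τ => F₂ (ξ', μ', τ))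
      (fun τ => F₃ (-(ξ + ξ'), -(μ + μ'), τ)) ^ 2 ≤ Kτ * (∫⁻ τ, F₁ (ξ, μ, τ) ^ 2) *
        (∫⁻ τ, F₂ (ξ', μ', τ) ^ 2) * ∫⁻ τ, F₃ (-(ξ + ξ'), -(μ + μ'), τ) ^ 2 := by
    intro ξ ξ' μ μ'
    refine (sq_trilinearForm_le_min_support (by fun_prop) (by fun_prop) (by fun_prop)
      (S₁ := Set.Icc (kpOmega ξ μ - 2 ^ j₁) (kpOmega ξ μ + 2 ^ j₁))
      (S₂ := Set.Icc (kpOmega ξ' μ' - 2 ^ j₂) (kpOmega ξ' μ' + 2 ^ j₂))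
      (S₃ := Set.Icc (kpOmega (-(ξ + ξ')) (-(μ + μ')) - 2 ^ j₃)
        (kpOmega (-(ξ + ξ')) (-(μ + μ')) + 2 ^ j₃))
      measurableSet_Icc measurableSet_Icc measurableSet_Icc ?_ ?_ ?_).trans_eq ?_
    · exact fun τ h => Set.mem_Icc_iff_abs_le.1 (by rw [abs_sub_comm]; exact (s₁ _ h).2)
    · exact fun τ h => Set.mem_Icc_iff_abs_le.1 (by rw [abs_sub_comm]; exact (s₂ _ h).2)
    · exact fun τ h => Set.mem_Icc_iff_abs_le.1 (by rw [abs_sub_comm]; exact (s₃ _ h).2)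
    · rw [hvolτ, hvolτ, hvolτ, hKτ, hmonoj.map_min, hmonoj.map_min]
  have hP : Measurable fun x : ℝ × ℝ × ℝ => ENNReal.ofReal (kpWeight x.1 x.2.1) * F₁ x := by
    have := measurable_kpWeight
    fun_prop
  -- the `μ`-integrals
  have Hμ : ∀ ξ ξ', trilinearForm (fun b => F₁ (ξ, b)) (fun b => F₂ (ξ', b))
      (fun b => F₃ (-(ξ + ξ'), b)) ^ 2 ≤ (Kτ * ENNReal.ofReal (Real.pi * A)) *
        (∫⁻ b : ℝ × ℝ, (ENNReal.ofReal (kpWeight ξ b.1) * F₁ (ξ, b)) ^ 2) *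
        (∫⁻ b, F₂ (ξ', b) ^ 2) * ∫⁻ b, F₃ (-(ξ + ξ'), b) ^ 2 := by
    intro ξ ξ'
    by_cases hξ : ξ ∈ dyadicShell k₁
    swap
    · have h0 : ∀ b, F₁ (ξ, b) = 0 := fun b => not_not.1 fun h => hξ (s₁ _ h).1
      simp [trilinearForm, h0]
    have hξ0 := pos_of_mem_dyadicShell hξ
    have m₁ : Measurable fun μ => ∫⁻ τ, F₁ (ξ, μ, τ) ^ 2 :=
      (by fun_prop : Measurable fun b : ℝ × ℝ => F₁ (ξ, b) ^ 2).lintegral_prod_right'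
    have m₂ : Measurable fun μ => ∫⁻ τ, F₂ (ξ', μ, τ) ^ 2 :=
      (by fun_prop : Measurable fun b : ℝ × ℝ => F₂ (ξ', b) ^ 2).lintegral_prod_right'
    have m₃ : Measurable fun μ => ∫⁻ τ, F₃ (-(ξ + ξ'), μ, τ) ^ 2 :=
      (by fun_prop : Measurable fun b : ℝ × ℝ => F₃ (-(ξ + ξ'), b) ^ 2).lintegral_prod_right'
    have mp : Measurable fun μ => kpWeight ξ μ := by unfold kpWeight; fun_prop
    refine (trilinearForm_prod_le (by fun_prop) (by fun_prop) (by fun_prop) m₁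
      (Hτ ξ ξ')).trans ?_
    have hY := sq_trilinearForm_le_lintegral (m₁.pow_const (1 / 2 : ℝ)) (m₂.pow_const (1 / 2 : ℝ))
      (m₃.pow_const (1 / 2 : ℝ))
    simp only [ENNReal.sqrt_sq] at hY
    have e₂ : ∫⁻ b, F₂ (ξ', b) ^ 2 = ∫⁻ μ, ∫⁻ τ, F₂ (ξ', μ, τ) ^ 2 :=
      lintegral_prod _ (by fun_prop)
    have e₃ : ∫⁻ b, F₃ (-(ξ + ξ'), b) ^ 2 = ∫⁻ μ, ∫⁻ τ, F₃ (-(ξ + ξ'), μ, τ) ^ 2 :=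
      lintegral_prod _ (by fun_prop)
    -- Young's inequality needs an L¹ norm in `μ` of the first factor, whose support is unbounded in
    -- `μ`. Inserting the weight and its inverse, Cauchy–Schwarz trades it for the weighted L² norm.
    have hW : (∫⁻ μ, (∫⁻ τ, F₁ (ξ, μ, τ) ^ 2) ^ (1 / 2 : ℝ)) ^ 2 ≤
        ENNReal.ofReal (Real.pi * A) *
          ∫⁻ b : ℝ × ℝ, (ENNReal.ofReal (kpWeight ξ b.1) * F₁ (ξ, b)) ^ 2 := by
      have e₁ : ∫⁻ b : ℝ × ℝ, (ENNReal.ofReal (kpWeight ξ b.1) * F₁ (ξ, b)) ^ 2 =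
          ∫⁻ μ, (ENNReal.ofReal (kpWeight ξ μ) * (∫⁻ τ, F₁ (ξ, μ, τ) ^ 2) ^ (1 / 2 : ℝ)) ^ 2 := by
        refine (lintegral_prod _ (by fun_prop)).trans (lintegral_congr fun μ => ?_)
        simp only [mul_pow]
        rw [lintegral_const_mul _ (by fun_prop), ENNReal.sqrt_sq]
      have e₀ : ∫⁻ μ, (∫⁻ τ, F₁ (ξ, μ, τ) ^ 2) ^ (1 / 2 : ℝ) =
          ∫⁻ μ, ENNReal.ofReal (kpWeight ξ μ)⁻¹ *
            (ENNReal.ofReal (kpWeight ξ μ) * (∫⁻ τ, F₁ (ξ, μ, τ) ^ 2) ^ (1 / 2 : ℝ)) := by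
        refine lintegral_congr fun μ => ?_
        have := one_le_kpWeight ξ μ
        rw [← mul_assoc, ← ENNReal.ofReal_mul (by positivity),
          inv_mul_cancel₀ (by positivity), ENNReal.ofReal_one, one_mul]
      rw [e₀, e₁]
      refine (sq_lintegral_mul_le (by fun_prop) (by fun_prop)).trans ?_
      gcongr
      refine (lintegral_inv_kpWeight_sq_le hξ0).trans (ENNReal.ofReal_le_ofReal ?_)
      have := hA ξ hξ
      have := Real.pi_pos
      gcongr
    calc _ ≤ _ := mul_le_mul_right hY _
      _ ≤ _ := by
        rw [e₂, e₃, mul_assoc Kτ, mul_assoc Kτ, mul_assoc Kτ]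
        gcongr
  -- the `ξ`-integrals
  have m₁ : Measurable fun ξ =>
      ∫⁻ b : ℝ × ℝ, (ENNReal.ofReal (kpWeight ξ b.1) * F₁ (ξ, b)) ^ 2 :=
    (hP.pow_const 2).lintegral_prod_right'
  have m₂ : Measurable fun ξ => ∫⁻ b, F₂ (ξ, b) ^ 2 := (h₂.pow_const 2).lintegral_prod_right'
  have m₃ : Measurable fun ξ => ∫⁻ b, F₃ (ξ, b) ^ 2 := (h₃.pow_const 2).lintegral_prod_right'
  refine (trilinearForm_prod_le h₁ h₂ h₃ m₁ Hμ).trans ?_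
  have hS := sq_trilinearForm_le_min_support (m₁.pow_const (1 / 2 : ℝ))
    (m₂.pow_const (1 / 2 : ℝ)) (m₃.pow_const (1 / 2 : ℝ))
    (S₁ := Set.Icc (-(2 : ℝ) ^ (k₁ + 1)) (2 ^ (k₁ + 1)))
    (S₂ := Set.Icc (-(2 : ℝ) ^ (k₂ + 1)) (2 ^ (k₂ + 1)))
    (S₃ := Set.Icc (-(2 : ℝ) ^ (k₃ + 1)) (2 ^ (k₃ + 1)))
    measurableSet_Icc measurableSet_Icc measurableSet_Icc
    (fun ξ h => by
      by_contra hξ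
      have h0 : ∀ b, F₁ (ξ, b) = 0 := fun b => not_not.1 fun h => hξ (abs_le.1 (s₁ _ h).1.2)
      simp [h0] at h)
    (fun ξ h => by
      by_contra hξ
      have h0 : ∀ b, F₂ (ξ, b) = 0 := fun b => not_not.1 fun h => hξ (abs_le.1 (s₂ _ h).1.2)
      simp [h0] at h)
    (fun ξ h => by
      by_contra hξ
      have h0 : ∀ b, F₃ (ξ, b) = 0 := fun b => not_not.1 fun h => hξ (abs_le.1 (s₃ _ h).1.2)
      simp [h0] at h)
  simp only [ENNReal.sqrt_sq] at hS
  rw [hvolξ, hvolξ, hvolξ, ← hmonok.map_min, ← hmonok.map_min] at hS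
  have e₁ : ∫⁻ x : ℝ × ℝ × ℝ, (ENNReal.ofReal (kpWeight x.1 x.2.1) * F₁ x) ^ 2 =
      ∫⁻ ξ, ∫⁻ b : ℝ × ℝ, (ENNReal.ofReal (kpWeight ξ b.1) * F₁ (ξ, b)) ^ 2 :=
    lintegral_prod _ (hP.pow_const 2).aemeasurable
  have e₂ : ∫⁻ x, F₂ x ^ 2 = ∫⁻ ξ, ∫⁻ b, F₂ (ξ, b) ^ 2 := lintegral_prod _ (by fun_prop)
  have e₃ : ∫⁻ x, F₃ x ^ 2 = ∫⁻ ξ, ∫⁻ b, F₃ (ξ, b) ^ 2 := lintegral_prod _ (by fun_prop)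
  rw [e₁, e₂, e₃]
  refine (mul_le_mul_right hS _).trans_eq ?_
  simp only [mul_assoc]

/-! ### The L⁴ Strichartz estimate -/

instance volume_real_prod_real_isAddHaarMeasure :
    (volume : Measure (ℝ × ℝ)).IsAddHaarMeasure :=
  Measure.prod.instIsAddHaarMeasure volume volume

instance volume_real_prod_prod_isAddHaarMeasure :
    (volume : Measure (ℝ × ℝ × ℝ)).IsAddHaarMeasure :=
  Measure.prod.instIsAddHaarMeasure volume volume

theorem lintegral_eq_setLIntegral_of_forall_notMem {α : Type*} [MeasurableSpace α]
    {μ : Measure α} {f : α → ℝ≥0∞} {s : Set α} (hs : MeasurableSet s)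
    (h : ∀ x ∉ s, f x = 0) : ∫⁻ x, f x ∂μ = ∫⁻ x in s, f x ∂μ := by
  rw [← lintegral_indicator hs, Set.indicator_eq_self.2]
  intro x hx
  by_contra hxs
  exact hx (h x hxs)

/-- For `B > 0`, `|v|` lies between `s = √B - 2δ/√B` and `√B`: since `s √B = B - 2δ`, a smaller
`|v|` would give `v² ≤ |v| √B < B - 2δ`. This leaves two intervals of length `2δ/√B`. For `B ≤ 0`
the right side is zero by the convention for division by zero, and the set lies in `{0}`. -/
theorem volume_sq_mem_Icc_le (B : ℝ) {δ : ℝ} (hδ : 0 ≤ δ) :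
    volume {v : ℝ | B - 2 * δ ≤ v ^ 2 ∧ v ^ 2 ≤ B} ≤ ENNReal.ofReal (4 * δ / √B) := by
  rcases le_or_gt B 0 with hB | hB
  · have : {v : ℝ | B - 2 * δ ≤ v ^ 2 ∧ v ^ 2 ≤ B} ⊆ {0} := fun v hv => by
      have : v ^ 2 = 0 := le_antisymm (hv.2.trans hB) (sq_nonneg v)
      simpa using this
    rw [measure_mono_null this (by simp)]
    exact zero_le
  · set r := √B with hr
    have hr0 : 0 < r := Real.sqrt_pos.2 hB
    have hrB : r ^ 2 = B := Real.sq_sqrt hB.le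
    set s := r - 2 * δ / r with hs
    have hsr : s * r = r ^ 2 - 2 * δ := by rw [hs]; field_simp
    have hsub : {v : ℝ | B - 2 * δ ≤ v ^ 2 ∧ v ^ 2 ≤ B} ⊆ Set.Icc s r ∪ Set.Icc (-r) (-s) := by
      intro v hv
      have h1 : |v| ≤ r := abs_le_of_sq_le_sq (by rw [hrB]; exact hv.2) hr0.le
      have h2 : s ≤ |v| := by
        by_contra! h
        have := hv.1
        rw [← sq_abs, ← hrB, ← hsr] at this
        nlinarith [abs_nonneg v]
      rcases abs_cases v with ⟨h, _⟩ | ⟨h, _⟩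
      · left; constructor <;> linarith
      · right; constructor <;> linarith
    refine (measure_mono hsub).trans ((measure_union_le _ _).trans ?_)
    rw [Real.volume_Icc, Real.volume_Icc, ← ENNReal.ofReal_add]
    · refine ENNReal.ofReal_le_ofReal (le_of_eq ?_)
      rw [hs]; ring
    all_goals rw [hs]; have : 0 ≤ 2 * δ / r := by positivity
    all_goals linarith

/-- The function `arcsin (t / √R)` is a primitive, with range in an interval of length π whatever
`R` is. For `|t| ≥ √R` the square root is zero and so is the integrand. -/
theorem lintegral_one_div_sqrt_sub_sq_le (R : ℝ) :
    ∫⁻ t : ℝ, ENNReal.ofReal (1 / √(R - t ^ 2)) ≤ ENNReal.ofReal Real.pi := by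
  rcases le_or_gt R 0 with hR | hR
  · have : ∀ t : ℝ, √(R - t ^ 2) = 0 := fun t =>
      Real.sqrt_eq_zero_of_nonpos (by nlinarith [sq_nonneg t])
    simp [this]
  set r := √R with hr
  have hr0 : 0 < r := Real.sqrt_pos.2 hR
  have hrR : r ^ 2 = R := Real.sq_sqrt hR.le
  have hout : ∀ t ∉ Set.Ioo (-r) r, ENNReal.ofReal (1 / √(R - t ^ 2)) = 0 := fun t ht => by
    have h : r ≤ |t| := by
      by_contra! h
      exact ht (abs_lt.1 h)
    have : √(R - t ^ 2) = 0 := Real.sqrt_eq_zero_of_nonpos (by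
      rw [← sq_abs t, ← hrR]; nlinarith)
    simp [this]
  rw [lintegral_eq_setLIntegral_of_forall_notMem measurableSet_Ioo hout]
  have hder : ∀ t ∈ Set.Ioo (-r) r, HasDerivWithinAt (fun t => Real.arcsin (t / r))
      (1 / √(R - t ^ 2)) (Set.Ioo (-r) r) t := fun t ht => by
    have h1 : t / r < 1 := by rw [div_lt_one hr0]; exact ht.2
    have h2 : -1 < t / r := by rw [lt_div_iff₀ hr0]; linarith [ht.1]
    have h := (Real.hasDerivAt_arcsin h2.ne' h1.ne).comp t ((hasDerivAt_id t).div_const r)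
    refine (h.congr_deriv ?_).hasDerivWithinAt
    have : √(R - t ^ 2) = r * √(1 - (t / r) ^ 2) := by
      rw [← Real.sqrt_sq hr0.le, ← Real.sqrt_mul (sq_nonneg _), Real.sqrt_sq hr0.le, ← hrR]
      congr 1
      field_simp
    rw [this, one_div_mul_one_div_rev]
  have hinj : Set.InjOn (fun t => Real.arcsin (t / r)) (Set.Ioo (-r) r) := fun t ht s hs h => by
    have := Real.injOn_arcsin
      (show t / r ∈ Set.Icc (-1) 1 from
        ⟨by rw [le_div_iff₀ hr0]; linarith [ht.1], by rw [div_le_one hr0]; exact ht.2.le⟩)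
      (show s / r ∈ Set.Icc (-1) 1 from
        ⟨by rw [le_div_iff₀ hr0]; linarith [hs.1], by rw [div_le_one hr0]; exact hs.2.le⟩) h
    field_simp at this
    exact this
  have key := lintegral_image_eq_lintegral_abs_deriv_mul measurableSet_Ioo hder hinj (fun _ => 1)
  simp only [mul_one, lintegral_const, Measure.restrict_apply_univ, one_mul] at key
  calc _ = _ := by
        refine setLIntegral_congr_fun measurableSet_Ioo fun t _ => ?_
        simp only [abs_of_nonneg (show (0 : ℝ) ≤ 1 / √(R - t ^ 2) by positivity)]
    _ = _ := key.symm
    _ ≤ volume (Set.Icc (-(Real.pi / 2)) (Real.pi / 2)) := by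
        refine measure_mono ?_
        rintro _ ⟨t, _, rfl⟩
        exact Real.arcsin_mem_Icc _
    _ = _ := by rw [Real.volume_Icc]; congr 1; ring

/-- The resonance identity in the variables with fixed sums. -/
theorem kpOmega_add_kpOmega {x ξ : ℝ} (hx : x ≠ 0) (hx' : ξ - x ≠ 0) (hξ : ξ ≠ 0) (y μ : ℝ) :
    kpOmega x y + kpOmega (ξ - x) (μ - y) = kpOmega ξ μ +
      (y - μ * x / ξ) ^ 2 / (x * (ξ - x) / ξ) - 3 * (x * (ξ - x) / ξ) * ξ ^ 2 := by
  unfold kpOmega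
  field_simp
  ring

theorem measurable_kpPhase (ξ μ : ℝ) :
    Measurable fun p : ℝ × ℝ => kpOmega p.1 p.2 + kpOmega (ξ - p.1) (μ - p.2) := by
  unfold kpOmega
  fun_prop

theorem measurableSet_kpPhase (ξ μ τ M : ℝ) :
    MeasurableSet {p : ℝ × ℝ | p.1 ∈ Set.Ioo 0 ξ ∧
      |τ - (kpOmega p.1 p.2 + kpOmega (ξ - p.1) (μ - p.2))| ≤ M} := by
  have h := measurable_kpPhase ξ μ
  exact (measurable_fst measurableSet_Ioo).inter
    (measurableSet_le (f := fun p : ℝ × ℝ =>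
      |τ - (kpOmega p.1 p.2 + kpOmega (ξ - p.1) (μ - p.2))|) (by fun_prop) measurable_const)

/-- Sublevel sets of the phase have area proportional to the level, with no further loss. -/
theorem volume_kpPhase_le (ξ μ τ : ℝ) {M : ℝ} (hM : 0 ≤ M) :
    volume {p : ℝ × ℝ | p.1 ∈ Set.Ioo 0 ξ ∧
      |τ - (kpOmega p.1 p.2 + kpOmega (ξ - p.1) (μ - p.2))| ≤ M} ≤
      ENNReal.ofReal (4 * M * Real.pi) := by
  set c := τ - kpOmega ξ μ with hc
  -- Chosen so that `3ξ(R - (x - ξ/2)²)` is at most `3ξ x(ξ - x) + c + M`, the quantity called `B /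
  -- a` below; here `x(ξ - x) = ξ²/4 - (x - ξ/2)²`.
  set R := ξ ^ 2 / 4 + min (c + M) 0 / (3 * ξ) with hR
  rw [Measure.volume_eq_prod, Measure.prod_apply (measurableSet_kpPhase ξ μ τ M)]
  calc _ ≤ ∫⁻ x : ℝ, ENNReal.ofReal (4 * M) *
        ENNReal.ofReal (1 / √(R - (x + -(ξ / 2)) ^ 2)) := by
        refine lintegral_mono fun x => ?_
        by_cases hx : x ∈ Set.Ioo 0 ξ
        swap
        · have : (Prod.mk x ⁻¹' {p : ℝ × ℝ | p.1 ∈ Set.Ioo 0 ξ ∧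
              |τ - (kpOmega p.1 p.2 + kpOmega (ξ - p.1) (μ - p.2))| ≤ M}) = ∅ :=
            Set.eq_empty_of_forall_notMem fun y hy => hx hy.1
          rw [this, measure_empty]
          exact zero_le
        have hx0 : 0 < x := hx.1
        have hx1 : 0 < ξ - x := sub_pos.2 hx.2
        have hξ : 0 < ξ := hx0.trans hx.2
        set a := x * (ξ - x) / ξ with ha
        have ha0 : 0 < a := by positivity
        set B := a * (c + M) + 3 * a ^ 2 * ξ ^ 2 with hB
        have hset : (Prod.mk x ⁻¹' {p : ℝ × ℝ | p.1 ∈ Set.Ioo 0 ξ ∧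
              |τ - (kpOmega p.1 p.2 + kpOmega (ξ - p.1) (μ - p.2))| ≤ M}) ⊆
            (fun y => y + -(μ * x / ξ)) ⁻¹'
              {v : ℝ | B - 2 * (a * M) ≤ v ^ 2 ∧ v ^ 2 ≤ B} := by
          intro y hy
          have h : |τ - (kpOmega x y + kpOmega (ξ - x) (μ - y))| ≤ M := hy.2
          rw [kpOmega_add_kpOmega hx0.ne' hx1.ne' hξ.ne', ← ha] at h
          set v := y + -(μ * x / ξ) with hv
          have e : y - μ * x / ξ = v := by rw [hv]; ring
          rw [e] at h
          have e2 : a * (v ^ 2 / a) = v ^ 2 := by field_simp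
          obtain ⟨h1, h2⟩ := abs_le.1 h
          have h1 := mul_le_mul_of_nonneg_left h1 ha0.le
          have h2 := mul_le_mul_of_nonneg_left h2 ha0.le
          show B - 2 * (a * M) ≤ v ^ 2 ∧ v ^ 2 ≤ B
          rw [← e2, hB, hc]
          constructor <;> linarith
        refine (measure_mono hset).trans ?_
        rw [measure_preimage_add_right]
        refine (volume_sq_mem_Icc_le B (by positivity)).trans ?_
        rw [← ENNReal.ofReal_mul (by positivity)]
        refine ENNReal.ofReal_le_ofReal ?_
        set q := R - (x + -(ξ / 2)) ^ 2 with hq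
        have hq' : 3 * ξ * q = 3 * ξ * (x * (ξ - x)) + min (c + M) 0 := by
          rw [hq, hR]; field_simp; ring
        have hB' : B = a * (3 * ξ * (x * (ξ - x)) + (c + M)) := by
          rw [hB, ha]; field_simp; ring
        have haξ : a ≤ ξ := by
          rw [ha, div_le_iff₀ hξ]; nlinarith
        -- For `q > 0`, the choice of `R` and `a ≤ ξ` give `B ≥ 3aξq ≥ a²q`. For `q ≤ 0` also `B ≤
        -- 0`, and both sides are zero as quotients by zero.
        suffices h : a / √B ≤ 1 / √q by
          calc 4 * (a * M) / √B = 4 * M * (a / √B) := by ring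
            _ ≤ _ := by gcongr
        rcases le_or_gt q 0 with h | h
        · have h3 : 3 * ξ * q ≤ 0 := by nlinarith
          have h4 : c + M < 0 := by
            by_contra! h5
            rw [min_eq_right h5] at hq'
            nlinarith [mul_pos hξ (mul_pos hx0 hx1)]
          rw [min_eq_left h4.le] at hq'
          rw [hB', ← hq', Real.sqrt_eq_zero_of_nonpos (by nlinarith)]
          simp
        · have h3 : a * (3 * ξ * q) ≤ B := by
            rw [hB', hq']
            gcongr
            exact min_le_left _ _
          have h4 : 0 < a * (3 * ξ * q) := by positivity
          rw [div_le_div_iff₀ (Real.sqrt_pos.2 (by linarith)) (Real.sqrt_pos.2 h), one_mul]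
          apply Real.le_sqrt_of_sq_le
          rw [mul_pow, Real.sq_sqrt h.le]
          refine le_trans ?_ h3
          rw [sq, mul_assoc]
          gcongr
          linarith
    _ = ENNReal.ofReal (4 * M) * ∫⁻ x : ℝ, ENNReal.ofReal (1 / √(R - x ^ 2)) := by
        rw [lintegral_const_mul' _ _ ENNReal.ofReal_ne_top]
        congr 1
        exact lintegral_add_right_eq_self (fun x : ℝ => ENNReal.ofReal (1 / √(R - x ^ 2))) _
    _ ≤ _ := by
        rw [ENNReal.ofReal_mul (by positivity : 0 ≤ 4 * M)]
        gcongr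
        exact lintegral_one_div_sqrt_sub_sq_le R

/-- The set of `t` with positive frequencies `t`, `x - t`, both within given distances
of the characteristic surface. -/
def kpFiber (J₁ J₂ : ℝ) (x : ℝ × ℝ × ℝ) : Set (ℝ × ℝ × ℝ) :=
  {t | t.1 ∈ Set.Ioo 0 x.1 ∧ |t.2.2 - kpOmega t.1 t.2.1| ≤ J₁ ∧
    |x.2.2 - t.2.2 - kpOmega (x.1 - t.1) (x.2.1 - t.2.1)| ≤ J₂}

theorem measurableSet_kpFiber (J₁ J₂ : ℝ) (x : ℝ × ℝ × ℝ) : MeasurableSet (kpFiber J₁ J₂ x) := by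
  refine (measurable_fst measurableSet_Ioo).inter (MeasurableSet.inter
    (measurableSet_le (f := fun t : ℝ × ℝ × ℝ => |t.2.2 - kpOmega t.1 t.2.1|)
      ?_ measurable_const) (measurableSet_le (f := fun t : ℝ × ℝ × ℝ =>
        |x.2.2 - t.2.2 - kpOmega (x.1 - t.1) (x.2.1 - t.2.1)|) ?_ measurable_const))
  all_goals unfold kpOmega; fun_prop

/-- At fixed `(ξ₁, μ₁)` the admissible `τ₁` lie in two intervals, so have measure at most `2 min(J₁,
J₂)`, and there are none unless the phase is within `J₁ + J₂` of `τ`. Since `min(J₁, J₂)(J₁ + J₂) ≤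
2 J₁ J₂`, the area bound for the phase gives the product `J₁ J₂`. -/
theorem volume_kpFiber_le {J₁ J₂ : ℝ} (hJ₁ : 0 ≤ J₁) (hJ₂ : 0 ≤ J₂) (x : ℝ × ℝ × ℝ) :
    volume (kpFiber J₁ J₂ x) ≤ ENNReal.ofReal (16 * Real.pi * J₁ * J₂) := by
  obtain ⟨ξ, μ, τ⟩ := x
  set A := {p : ℝ × ℝ | p.1 ∈ Set.Ioo 0 ξ ∧
      |τ - (kpOmega p.1 p.2 + kpOmega (ξ - p.1) (μ - p.2))| ≤ J₁ + J₂} with hA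
  have hAm : MeasurableSet A := measurableSet_kpPhase ξ μ τ _
  have hE := measurableSet_kpFiber J₁ J₂ (ξ, μ, τ)
  calc volume (kpFiber J₁ J₂ (ξ, μ, τ))
      = ∫⁻ a, ∫⁻ b, volume (Prod.mk b ⁻¹' (Prod.mk a ⁻¹' kpFiber J₁ J₂ (ξ, μ, τ))) := by
        rw [Measure.volume_eq_prod, Measure.prod_apply hE]
        refine lintegral_congr fun a => ?_
        rw [Measure.volume_eq_prod, Measure.prod_apply (measurable_prodMk_left hE)]
    _ ≤ ∫⁻ a, ∫⁻ b, ENNReal.ofReal (2 * min J₁ J₂) * A.indicator 1 (a, b) := by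
        refine lintegral_mono fun a => lintegral_mono fun b => ?_
        by_cases hab : (a, b) ∈ A
        · rw [Set.indicator_of_mem hab, Pi.one_apply, mul_one]
          rcases min_choice J₁ J₂ with h | h <;> rw [h]
          · refine (measure_mono (t := Set.Icc (kpOmega a b - J₁) (kpOmega a b + J₁))
              fun t ht => ?_).trans_eq ?_
            · have h : |t - kpOmega a b| ≤ J₁ := ht.2.1
              exact Set.mem_Icc_iff_abs_le.1 (by rwa [abs_sub_comm])
            · rw [Real.volume_Icc]; congr 1; ring
          · refine (measure_mono (t := Set.Icc (τ - kpOmega (ξ - a) (μ - b) - J₂)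
              (τ - kpOmega (ξ - a) (μ - b) + J₂)) fun t ht => ?_).trans_eq ?_
            · have h : |τ - t - kpOmega (ξ - a) (μ - b)| ≤ J₂ := ht.2.2
              refine Set.mem_Icc_iff_abs_le.1 ?_
              rwa [sub_right_comm] at h
            · rw [Real.volume_Icc]; congr 1; ring
        · rw [Set.indicator_of_notMem hab, mul_zero, nonpos_iff_eq_zero]
          convert measure_empty (μ := (volume : Measure ℝ))
          refine Set.eq_empty_of_forall_notMem fun t ht => hab ⟨ht.1, ?_⟩
          have h₁ : |t - kpOmega a b| ≤ J₁ := ht.2.1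
          have h₂ : |τ - t - kpOmega (ξ - a) (μ - b)| ≤ J₂ := ht.2.2
          show |τ - (kpOmega a b + kpOmega (ξ - a) (μ - b))| ≤ J₁ + J₂
          calc _ = |(t - kpOmega a b) + (τ - t - kpOmega (ξ - a) (μ - b))| := by congr 1; ring
            _ ≤ _ := (abs_add_le _ _).trans (add_le_add h₁ h₂)
    _ = ENNReal.ofReal (2 * min J₁ J₂) * volume A := by
        simp only [lintegral_const_mul' _ _ ENNReal.ofReal_ne_top]
        rw [← lintegral_indicator_one hAm]
        congr 1
        exact (lintegral_prod _ (measurable_one.indicator hAm).aemeasurable).symm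
    _ ≤ ENNReal.ofReal (2 * min J₁ J₂) * ENNReal.ofReal (4 * (J₁ + J₂) * Real.pi) := by
        gcongr
        exact volume_kpPhase_le ξ μ τ (by positivity)
    _ ≤ _ := by
        rw [← ENNReal.ofReal_mul (by positivity)]
        refine ENNReal.ofReal_le_ofReal ?_
        have : min J₁ J₂ * (J₁ + J₂) ≤ 2 * (J₁ * J₂) := by
          rcases le_total J₁ J₂ with h | h
          · rw [min_eq_left h]; nlinarith
          · rw [min_eq_right h]; nlinarith
        nlinarith [Real.pi_pos]

theorem lintegral_sq_lconv_le_of_pos {J₁ J₂ : ℝ} (hJ₁ : 0 ≤ J₁) (hJ₂ : 0 ≤ J₂)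
    {F₁ F₂ : ℝ × ℝ × ℝ → ℝ≥0∞} (h₁ : Measurable F₁) (h₂ : Measurable F₂)
    (s₁ : ∀ x, F₁ x ≠ 0 → 0 < x.1 ∧ |x.2.2 - kpOmega x.1 x.2.1| ≤ J₁)
    (s₂ : ∀ x, F₂ x ≠ 0 → 0 < x.1 ∧ |x.2.2 - kpOmega x.1 x.2.1| ≤ J₂) :
    ∫⁻ x, lconv F₁ F₂ x ^ 2 ≤
      ENNReal.ofReal (16 * Real.pi * J₁ * J₂) * (∫⁻ x, F₁ x ^ 2) * ∫⁻ x, F₂ x ^ 2 := by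
  refine lintegral_sq_lconv_le_of_fiber h₁ h₂ (measurableSet_kpFiber J₁ J₂) (fun x t h => ?_)
    (volume_kpFiber_le hJ₁ hJ₂)
  have e₁ := s₁ t (left_ne_zero_of_mul h)
  have e₂ := s₂ (x - t) (right_ne_zero_of_mul h)
  exact ⟨⟨e₁.1, sub_pos.1 e₂.1⟩, e₁.2, e₂.2⟩

/-- An estimate for second factors of positive frequency extends to all second factors. -/
theorem lintegral_sq_lconv_le_of_forall_pos {J : ℝ} {B : ℝ≥0∞} {F₁ F₂ : ℝ × ℝ × ℝ → ℝ≥0∞}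
    (h₁ : Measurable F₁) (h₂ : Measurable F₂)
    (s₂ : ∀ x, F₂ x ≠ 0 → x.1 ≠ 0 ∧ |x.2.2 - kpOmega x.1 x.2.1| ≤ J)
    (hB : ∀ G : ℝ × ℝ × ℝ → ℝ≥0∞, Measurable G →
      (∀ x, G x ≠ 0 → 0 < x.1 ∧ |x.2.2 - kpOmega x.1 x.2.1| ≤ J) →
      ∫⁻ x, lconv F₁ G x ^ 2 ≤ B * ∫⁻ x, G x ^ 2) :
    ∫⁻ x, lconv F₁ F₂ x ^ 2 ≤ 4 * B * ∫⁻ x, F₂ x ^ 2 := by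
  set P : Set (ℝ × ℝ × ℝ) := {x | 0 < x.1} with hP
  have hPm : MeasurableSet P := measurableSet_lt measurable_const measurable_fst
  have mp := h₂.indicator hPm
  have mn := h₂.indicator hPm.compl
  have hle : ∀ S : Set (ℝ × ℝ × ℝ), ∫⁻ x, S.indicator F₂ x ^ 2 ≤ ∫⁻ x, F₂ x ^ 2 := fun S =>
    lintegral_mono fun x => pow_le_pow_left' (Set.indicator_le_self _ _ _) 2
  have bp : ∫⁻ x, lconv F₁ (P.indicator F₂) x ^ 2 ≤ B * ∫⁻ x, F₂ x ^ 2 := by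
    refine (hB _ mp fun x hx => ?_).trans (mul_le_mul_right (hle P) _)
    by_cases h : x ∈ P
    · rw [Set.indicator_of_mem h] at hx
      exact ⟨h, (s₂ x hx).2⟩
    · simp [h] at hx
  -- The part of nonpositive frequency is reflected to positive frequency: this leaves the norm of
  -- the convolution unchanged, and the modulation too, since ω is odd.
  have bn : ∫⁻ x, lconv F₁ (Pᶜ.indicator F₂) x ^ 2 ≤ B * ∫⁻ x, F₂ x ^ 2 := by
    rw [← lintegral_sq_lconv_reflect h₁ mn]
    refine (hB _ (by fun_prop) fun x hx => ?_).trans ?_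
    · by_cases h : -x ∈ Pᶜ
      · rw [Set.indicator_of_mem h] at hx
        obtain ⟨h0, hJ⟩ := s₂ _ hx
        have h' : ¬ 0 < -x.1 := h
        simp only [Prod.fst_neg, Prod.snd_neg, kpOmega_neg, neg_sub_neg] at h0 hJ
        rw [abs_sub_comm] at hJ
        refine ⟨lt_of_le_of_ne (by linarith) ?_, hJ⟩
        intro h; apply h0; rw [← h, neg_zero]
      · simp [h] at hx
    · rw [lintegral_neg_eq_self (fun x => Pᶜ.indicator F₂ x ^ 2)]
      exact mul_le_mul_right (hle _) _
  calc _ ≤ ∫⁻ x, (2 * lconv F₁ (P.indicator F₂) x ^ 2 + 2 * lconv F₁ (Pᶜ.indicator F₂) x ^ 2) := by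
        refine lintegral_mono fun x => ?_
        have : lconv F₁ F₂ x = lconv F₁ (P.indicator F₂) x + lconv F₁ (Pᶜ.indicator F₂) x := by
          unfold lconv
          rw [← lintegral_add_left (by fun_prop)]
          refine lintegral_congr fun t => ?_
          rw [← mul_add, Set.indicator_self_add_compl_apply]
        rw [this]
        exact ENNReal.add_sq_le _ _
    _ = 2 * (∫⁻ x, lconv F₁ (P.indicator F₂) x ^ 2) +
        2 * ∫⁻ x, lconv F₁ (Pᶜ.indicator F₂) x ^ 2 := by
        rw [lintegral_add_left (((measurable_lconv h₁ mp).pow_const 2).const_mul 2),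
          lintegral_const_mul' _ _ (by simp), lintegral_const_mul' _ _ (by simp)]
    _ ≤ 2 * (B * ∫⁻ x, F₂ x ^ 2) + 2 * (B * ∫⁻ x, F₂ x ^ 2) := by gcongr
    _ = _ := by ring

/-- The bilinear `L⁴` Strichartz estimate on the frequency side. -/
theorem lintegral_sq_lconv_le_of_modulation {J₁ J₂ : ℝ} (hJ₁ : 0 ≤ J₁) (hJ₂ : 0 ≤ J₂)
    {F₁ F₂ : ℝ × ℝ × ℝ → ℝ≥0∞} (h₁ : Measurable F₁) (h₂ : Measurable F₂)
    (s₁ : ∀ x, F₁ x ≠ 0 → x.1 ≠ 0 ∧ |x.2.2 - kpOmega x.1 x.2.1| ≤ J₁)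
    (s₂ : ∀ x, F₂ x ≠ 0 → x.1 ≠ 0 ∧ |x.2.2 - kpOmega x.1 x.2.1| ≤ J₂) :
    ∫⁻ x, lconv F₁ F₂ x ^ 2 ≤
      ENNReal.ofReal (256 * Real.pi * J₁ * J₂) * (∫⁻ x, F₁ x ^ 2) * ∫⁻ x, F₂ x ^ 2 := by
  -- Dropping the sign condition costs a factor 4 in each of the two arguments, whence `256 = 16 *
  -- 16`.
  have key : ∀ G : ℝ × ℝ × ℝ → ℝ≥0∞, Measurable G →
      (∀ x, G x ≠ 0 → 0 < x.1 ∧ |x.2.2 - kpOmega x.1 x.2.1| ≤ J₁) →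
      ∫⁻ x, lconv G F₂ x ^ 2 ≤
        4 * (ENNReal.ofReal (16 * Real.pi * J₁ * J₂) * ∫⁻ x, G x ^ 2) * ∫⁻ x, F₂ x ^ 2 :=
    fun G hG sG => lintegral_sq_lconv_le_of_forall_pos hG h₂ s₂ fun G' hG' sG' =>
      lintegral_sq_lconv_le_of_pos hJ₁ hJ₂ hG hG' sG sG'
  rw [lconv_comm]
  refine (lintegral_sq_lconv_le_of_forall_pos h₂ h₁ s₁
    (B := 4 * ENNReal.ofReal (16 * Real.pi * J₁ * J₂) * ∫⁻ x, F₂ x ^ 2)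
    fun G hG sG => ?_).trans_eq ?_
  · rw [lconv_comm]
    exact (key G hG sG).trans_eq (by ring)
  · rw [show 256 * Real.pi * J₁ * J₂ = 16 * (16 * Real.pi * J₁ * J₂) by ring,
      ENNReal.ofReal_mul (p := 16) (by norm_num), ENNReal.ofReal_ofNat]
    ring

/-! ### The change of variables in the resonant interaction -/

theorem lintegral_lintegral_lintegral_rotate {f : ℝ → ℝ → ℝ → ℝ≥0∞}
    (hf : Measurable fun p : ℝ × ℝ × ℝ => f p.1 p.2.1 p.2.2) :
    ∫⁻ x, ∫⁻ y, ∫⁻ z, f x y z = ∫⁻ y, ∫⁻ z, ∫⁻ x, f x y z := by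
  rw [lintegral_lintegral_swap]
  · refine lintegral_congr fun y => ?_
    rw [lintegral_lintegral_swap]
    exact (hf.comp (by fun_prop : Measurable fun p : ℝ × ℝ => (p.1, y, p.2))).aemeasurable
  · exact (hf.comp (by fun_prop :
      Measurable fun p : (ℝ × ℝ) × ℝ => (p.1.1, p.1.2, p.2))).lintegral_prod_right'.aemeasurable

/-- Change of variables `ξ = x + z`, `w = e(ξ) - y`, `m = z w`. -/
theorem lintegral_comp_resonant {f : ℝ → ℝ → ℝ → ℝ≥0∞}
    (hf : Measurable fun p : ℝ × ℝ × ℝ => f p.1 p.2.1 p.2.2) (e : ℝ → ℝ) :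
    ∫⁻ x, ∫⁻ y, ∫⁻ z, f x y z =
      ∫⁻ ξ, ∫⁻ m, ∫⁻ w, ENNReal.ofReal |w⁻¹| * f (ξ - m / w) (e ξ - w) (m / w) := by
  have hne : ∀ᵐ w : ℝ, w ≠ 0 := by simp [ae_iff]
  calc _ = ∫⁻ y, ∫⁻ z, ∫⁻ x, f x y z := lintegral_lintegral_lintegral_rotate hf
    _ = ∫⁻ y, ∫⁻ z, ∫⁻ ξ, f (ξ - z) y z := by
        refine lintegral_congr fun y => lintegral_congr fun z => ?_
        exact (lintegral_sub_right_eq_self (fun x => f x y z) z).symm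
    _ = ∫⁻ ξ, ∫⁻ y, ∫⁻ z, f (ξ - z) y z := by
        rw [lintegral_lintegral_lintegral_rotate (f := fun ξ y z => f (ξ - z) y z)]
        exact hf.comp (by fun_prop : Measurable fun p : ℝ × ℝ × ℝ => (p.1 - p.2.2, p.2.1, p.2.2))
    _ = ∫⁻ ξ, ∫⁻ w, ∫⁻ m, ENNReal.ofReal |w⁻¹| * f (ξ - m / w) (e ξ - w) (m / w) := by
        refine lintegral_congr fun ξ => ?_
        rw [← lintegral_sub_left_eq_self _ (e ξ)]
        refine lintegral_congr_ae (hne.mono fun w hw => ?_)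
        simp only
        rw [lintegral_comp_affine (inv_ne_zero hw) 0]
        simp only [add_zero, ← div_eq_inv_mul]
    _ = _ := by
        refine lintegral_congr fun ξ => ?_
        rw [lintegral_lintegral_swap]
        have : Measurable fun p : ℝ × ℝ => f (ξ - p.2 / p.1) (e ξ - p.1) (p.2 / p.1) :=
          hf.comp (by fun_prop :
            Measurable fun p : ℝ × ℝ => (ξ - p.2 / p.1, e ξ - p.1, p.2 / p.1))
        fun_prop

theorem one_le_abs_of_sq_eq_three {σ : ℝ} (hσ : σ ^ 2 = 3) : 1 ≤ |σ| := by
  rw [← sq_abs] at hσ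
  nlinarith [abs_nonneg σ]

theorem abs_le_two_of_sq_eq_three {σ : ℝ} (hσ : σ ^ 2 = 3) : |σ| ≤ 2 := by
  rw [← sq_abs] at hσ
  nlinarith [abs_nonneg σ]

/-- The resonance function as a function of `w`, at fixed `ξ` and `m = ξ₂ w`. -/
noncomputable def resonanceAt (σ ξ m w : ℝ) : ℝ := m / ξ * ((ξ - m / w) * (w - 2 * σ * ξ))

theorem hasDerivAt_resonanceAt {σ ξ m w : ℝ} (hξ : ξ ≠ 0) (hw : w ≠ 0) :
    HasDerivAt (resonanceAt σ ξ m) (m / w * (w - 2 * σ * (m / w))) w := by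
  have h1 : HasDerivAt (fun w => ξ - m / w) (m / w ^ 2) w := by
    have := ((hasDerivAt_inv hw).const_mul m).const_sub ξ
    refine this.congr_deriv ?_
    field_simp
  have h2 : HasDerivAt (fun w => w - 2 * σ * ξ) 1 w := (hasDerivAt_id w).sub_const _
  refine ((h1.mul h2).const_mul (m / ξ)).congr_deriv ?_
  field_simp
  ring

/-- The part of the `w`-line where the frequencies are nondegenerate. -/
def resonantSet (R ξ m : ℝ) (σ : ℝ) : Set ℝ :=
  {w | w ≠ 0 ∧ |w - 2 * σ * ξ| ≤ R ∧ R ≤ |ξ - m / w|}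

theorem measurableSet_resonantSet (R ξ m σ : ℝ) : MeasurableSet (resonantSet R ξ m σ) := by
  have : resonantSet R ξ m σ =
    {0}ᶜ ∩ ({w | |w - 2 * σ * ξ| ≤ R} ∩ {w | R ≤ |ξ - m / w|}) := rfl
  rw [this]
  exact (measurableSet_singleton 0).compl.inter
    ((measurableSet_le (by fun_prop) measurable_const).inter
      (measurableSet_le measurable_const (by fun_prop)))

/-- With `x = ξ - m / w`, the factor `w - 2σ(m/w)` of the derivative of the resonance is `2σx + (w -
2σξ)`. The error is at most `R ≤ |x|`, so it has the sign of `σx`. -/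
theorem mul_pos_of_mem_resonantSet {R ξ m σ w : ℝ} (hσ : σ ^ 2 = 3) (hR : 0 < R)
    (h : w ∈ resonantSet R ξ m σ) : 0 < (w - 2 * σ * (m / w)) * (σ * (ξ - m / w)) := by
  obtain ⟨-, h1, h2⟩ := h
  set x := ξ - m / w with hx
  have e : (w - 2 * σ * (m / w)) * (σ * x) = 2 * σ ^ 2 * x ^ 2 + (w - 2 * σ * ξ) * (σ * x) := by
    rw [show m / w = ξ - x by rw [hx]; ring]; ring
  have h3 : |(w - 2 * σ * ξ) * (σ * x)| ≤ 2 * x ^ 2 := by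
    rw [abs_mul, abs_mul, ← sq_abs x]
    have := abs_le_two_of_sq_eq_three hσ
    calc |w - 2 * σ * ξ| * (|σ| * |x|) ≤ |x| * (2 * |x|) :=
          mul_le_mul (h1.trans h2) (by gcongr) (by positivity) (by positivity)
      _ = _ := by ring
  have h4 : 0 < x ^ 2 := by rw [← sq_abs]; have := hR.trans_le h2; positivity
  rw [e, hσ]
  linarith [(abs_le.1 h3).1]

/-- Two distinct points with equal values satisfy `w w' = 2σm`, so the derivative factors there are
`w - w'` and `w' - w`. These have opposite signs, while the previous lemma gives them the same sign
when `ξ - m / w` and `ξ - m / w'` agree in sign. -/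
theorem injOn_resonanceAt {R ξ m σ : ℝ} (hσ : σ ^ 2 = 3) (hR : 0 < R) (hξ : ξ ≠ 0) (hm : m ≠ 0)
    {S : Set ℝ} (hS : S ⊆ resonantSet R ξ m σ)
    (hsign : ∀ w ∈ S, ∀ w' ∈ S, 0 < (ξ - m / w) * (ξ - m / w')) :
    Set.InjOn (resonanceAt σ ξ m) S := by
  intro w hw w' hw' h
  by_contra hne
  have hw0 := (hS hw).1
  have hw0' := (hS hw').1
  have hprod : w * w' = 2 * σ * m := by
    unfold resonanceAt at h
    have h := mul_left_cancel₀ (div_ne_zero hm hξ) h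
    field_simp at h
    have : ξ * (w - w') * (w * w' - 2 * σ * m) = 0 := by linear_combination h
    have h2 := (mul_eq_zero.1 this).resolve_left (mul_ne_zero hξ (sub_ne_zero.2 hne))
    linarith
  have e1 : 2 * σ * (m / w) = w' := by
    rw [← mul_div_assoc, ← hprod]; field_simp
  have e2 : 2 * σ * (m / w') = w := by
    rw [← mul_div_assoc, ← hprod]; field_simp
  have p1 := mul_pos_of_mem_resonantSet hσ hR (hS hw)
  have p2 := mul_pos_of_mem_resonantSet hσ hR (hS hw')
  rw [e1] at p1
  rw [e2] at p2
  have p := mul_pos p1 p2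
  have e : (w - w') * (σ * (ξ - m / w)) * ((w' - w) * (σ * (ξ - m / w'))) =
      -((w - w') ^ 2 * σ ^ 2 * ((ξ - m / w) * (ξ - m / w'))) := by ring
  rw [e] at p
  have := hsign w hw w' hw'
  have : 0 ≤ (w - w') ^ 2 * σ ^ 2 * ((ξ - m / w) * (ξ - m / w')) := by positivity
  linarith

/-- Put `z = m / w`, `x = ξ - z`. The resonance has derivative `z(w - 2σz)` in `w`; since `|σ| ≥ 1`,
both `|w - 2σz| ≥ 2|x| - R ≥ |x|` and `|w| ≥ 2|ξ| - R ≥ κ`. So the weight `|x||z|/|w|` is at most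
`1/κ` times the Jacobian of the resonance. The factor 2 counts the two signs of `x`, on each of
which the resonance is injective. -/
theorem setLIntegral_resonanceAt_le {R ξ m σ κ : ℝ} (hσ : σ ^ 2 = 3) (hR : 0 < R) (hκ : 0 < κ)
    (hRξ : R ≤ |ξ|) (hκξ : κ ≤ |ξ|) (hm : m ≠ 0) (g : ℝ → ℝ≥0∞) :
    ∫⁻ w in resonantSet R ξ m σ,
      ENNReal.ofReal (|w⁻¹| * (|ξ - m / w| * |m / w|)) * g (resonanceAt σ ξ m w) ≤
      ENNReal.ofReal (2 / κ) * ∫⁻ t, g t := by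
  have hξ0 : ξ ≠ 0 := abs_pos.1 (hκ.trans_le hκξ)
  have hmeas := measurableSet_resonantSet R ξ m σ
  have piece : ∀ S ⊆ resonantSet R ξ m σ, MeasurableSet S →
      (∀ w ∈ S, ∀ w' ∈ S, 0 < (ξ - m / w) * (ξ - m / w')) →
      ∫⁻ w in S, ENNReal.ofReal (|w⁻¹| * (|ξ - m / w| * |m / w|)) * g (resonanceAt σ ξ m w) ≤
        ENNReal.ofReal (1 / κ) * ∫⁻ t, g t := by
    intro S hS hSm hsign
    have key := lintegral_image_eq_lintegral_abs_deriv_mul hSm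
      (fun w hw => (hasDerivAt_resonanceAt (σ := σ) (m := m) hξ0 (hS hw).1).hasDerivWithinAt)
      (injOn_resonanceAt hσ hR hξ0 hm hS hsign) g
    calc _ ≤ ∫⁻ w in S, ENNReal.ofReal (1 / κ) *
          (ENNReal.ofReal |m / w * (w - 2 * σ * (m / w))| * g (resonanceAt σ ξ m w)) := by
          refine setLIntegral_mono' hSm fun w hw => ?_
          rw [← mul_assoc (ENNReal.ofReal (1 / κ)), ← ENNReal.ofReal_mul (by positivity)]
          gcongr ENNReal.ofReal ?_ * _
          obtain ⟨hw0, h1, h2⟩ := hS hw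
          have hσ1 := one_le_abs_of_sq_eq_three hσ
          have hwκ : κ ≤ |w| := by
            have e : 2 * σ * ξ = w - (w - 2 * σ * ξ) := by ring
            have h3 : |2 * σ * ξ| ≤ |w| + |w - 2 * σ * ξ| := by
              nth_rw 1 [e]; exact abs_sub _ _
            rw [abs_mul, abs_mul, abs_two] at h3
            nlinarith [abs_nonneg ξ]
          have hx : |ξ - m / w| ≤ |w - 2 * σ * (m / w)| := by
            have e : 2 * σ * (ξ - m / w) = (w - 2 * σ * (m / w)) - (w - 2 * σ * ξ) := by ring
            have h3 : |2 * σ * (ξ - m / w)| ≤ |w - 2 * σ * (m / w)| + |w - 2 * σ * ξ| := by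
              rw [e]; exact abs_sub _ _
            rw [abs_mul, abs_mul, abs_two] at h3
            nlinarith [abs_nonneg (ξ - m / w)]
          rw [abs_mul, abs_inv, mul_comm |m / w|, ← one_div]
          gcongr
      _ = ENNReal.ofReal (1 / κ) * ∫⁻ x in resonanceAt σ ξ m '' S, g x := by
          rw [key, lintegral_const_mul' _ _ ENNReal.ofReal_ne_top]
      _ ≤ _ := by
          gcongr
          exact Measure.restrict_le_self
  set P : Set ℝ := {w | 0 < ξ - m / w} with hP
  have hPm : MeasurableSet P := measurableSet_lt measurable_const (by fun_prop)
  rw [← lintegral_inter_add_sdiff _ _ hPm]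
  have h1 := piece (resonantSet R ξ m σ ∩ P) Set.inter_subset_left (hmeas.inter hPm)
    fun w hw w' hw' => mul_pos hw.2 hw'.2
  have h2 := piece (resonantSet R ξ m σ \ P) Set.sdiff_subset (hmeas.diff hPm)
    fun w hw w' hw' => by
      have aux : ∀ v ∈ resonantSet R ξ m σ \ P, ξ - m / v < 0 := fun v hv =>
        lt_of_le_of_ne (not_lt.1 hv.2) (abs_pos.1 (hR.trans_le hv.1.2.2))
      exact mul_pos_of_neg_of_neg (aux w hw) (aux w' hw')
  refine (add_le_add h1 h2).trans_eq ?_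
  rw [← add_mul, ← ENNReal.ofReal_add (by positivity) (by positivity)]
  congr 2
  ring

/-- The resonance function is `xz/ξ` times `(μ₁/x - μ₂/z)² - 3ξ²`, a difference of squares because
`σ² = 3`. On the two parabolas `μ₁/x - μ₂/z = σξ + (β - y)`, so one factor is the difference of
labels. -/
theorem kpOmega_resonant {σ : ℝ} (hσ : σ ^ 2 = 3) {β ξ x y z : ℝ} (hξ : x + z = ξ)
    (hξ0 : ξ ≠ 0) :
    kpOmega x (σ * x ^ 2 + β * x) + kpOmega z (-σ * z ^ 2 + y * z) =
      kpOmega ξ (σ * x ^ 2 + β * x + (-σ * z ^ 2 + y * z)) +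
        x * z / ξ * (β - y) * (β - y + 2 * σ * ξ) := by
  subst hξ
  unfold kpOmega
  field_simp
  linear_combination (x * z * (x + z) ^ 2) * hσ

/-- The points of the region of integration in the resonant interaction. -/
def resonantRegion (β R κ : ℝ) : Set (ℝ × ℝ × ℝ) :=
  {q | |β - q.2.1| ≤ R ∧ R ≤ |q.1| ∧ q.2.2 ≠ 0 ∧ R ≤ |q.1 + q.2.2| ∧ κ ≤ |q.1 + q.2.2|}

theorem measurableSet_resonantRegion (β R κ : ℝ) : MeasurableSet (resonantRegion β R κ) := by
  have : resonantRegion β R κ = {q | |β - q.2.1| ≤ R} ∩ ({q | R ≤ |q.1|} ∩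
      ((fun q => q.2.2) ⁻¹' {0}ᶜ ∩ ({q | R ≤ |q.1 + q.2.2|} ∩ {q | κ ≤ |q.1 + q.2.2|}))) := rfl
  rw [this]
  refine (measurableSet_le (by fun_prop) (by fun_prop)).inter
    ((measurableSet_le (by fun_prop) (by fun_prop)).inter (MeasurableSet.inter ?_
      ((measurableSet_le (by fun_prop) (by fun_prop)).inter
        (measurableSet_le (by fun_prop) (by fun_prop)))))
  exact measurable_snd.snd (measurableSet_singleton 0).compl

/-- In the variables `ξ = x + z`, `w = β - y + 2σξ`, `m = zw`, the second component of the sum is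
`σξ² + βξ - m`, independent of `w`. Hence `ξ` and `m` give the first two components, and `w` moves
only the third, through the resonance. The weight `|x||z|` is the product of the Jacobians of the
two charts. -/
theorem lintegral_resonantRegion_le {σ R κ : ℝ} (hσ : σ ^ 2 = 3) (hR : 0 < R) (hκ : 0 < κ)
    (β θ : ℝ) {E : ℝ × ℝ × ℝ → ℝ≥0∞} (hE : Measurable E) :
    ∫⁻ x, ∫⁻ y, ∫⁻ z, (resonantRegion β R κ).indicator (fun q => ENNReal.ofReal (|q.1| * |q.2.2|) *
      E (q.1 + q.2.2, (σ * q.1 ^ 2 + β * q.1) + (-σ * q.2.2 ^ 2 + q.2.1 * q.2.2),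
        kpOmega q.1 (σ * q.1 ^ 2 + β * q.1) + kpOmega q.2.2 (-σ * q.2.2 ^ 2 + q.2.1 * q.2.2) + θ))
      (x, y, z) ≤ ENNReal.ofReal (2 / κ) * ∫⁻ x, E x := by
  set G := resonantRegion β R κ with hG
  set Ψ : ℝ × ℝ × ℝ → ℝ≥0∞ := fun q => ENNReal.ofReal (|q.1| * |q.2.2|) *
      E (q.1 + q.2.2, (σ * q.1 ^ 2 + β * q.1) + (-σ * q.2.2 ^ 2 + q.2.1 * q.2.2),
        kpOmega q.1 (σ * q.1 ^ 2 + β * q.1) + kpOmega q.2.2 (-σ * q.2.2 ^ 2 + q.2.1 * q.2.2) + θ)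
    with hΨ
  have hΨm : Measurable Ψ := by
    rw [hΨ]
    unfold kpOmega
    fun_prop
  have hm := hΨm.indicator (measurableSet_resonantRegion β R κ)
  rw [lintegral_comp_resonant (f := fun x y z => G.indicator Ψ (x, y, z)) hm
    (fun ξ => 2 * σ * ξ + β)]
  have hEeq : ∫⁻ x, E x = ∫⁻ ξ, ∫⁻ μ, ∫⁻ τ, E (ξ, μ, τ) := by
    rw [Measure.volume_eq_prod, lintegral_prod _ hE.aemeasurable]
    refine lintegral_congr fun ξ => ?_
    rw [Measure.volume_eq_prod, lintegral_prod _ (by fun_prop)]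
  rw [hEeq, ← lintegral_const_mul' _ _ ENNReal.ofReal_ne_top]
  refine lintegral_mono fun ξ => ?_
  set c₀ := σ * ξ ^ 2 + β * ξ with hc₀
  rw [← lintegral_sub_left_eq_self (fun μ => ∫⁻ τ, E (ξ, μ, τ)) c₀, ← lintegral_const_mul' _ _ ENNReal.ofReal_ne_top]
  refine lintegral_mono fun m => ?_
  by_cases hgood : R ≤ |ξ| ∧ κ ≤ |ξ| ∧ m ≠ 0
  swap
  · refine (lintegral_eq_zero_of_ae_eq_zero (Filter.Eventually.of_forall fun w => ?_)).trans_le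
      zero_le
    have : (ξ - m / w, 2 * σ * ξ + β - w, m / w) ∉ G := fun h => hgood (by
      obtain ⟨-, -, h3, h4, h5⟩ := h
      simp only [sub_add_cancel] at h3 h4 h5
      exact ⟨h4, h5, fun h => h3 (by simp [h])⟩)
    simp [this]
  obtain ⟨hRξ, hκξ, hm0⟩ := hgood
  have hξ0 : ξ ≠ 0 := abs_pos.1 (hκ.trans_le hκξ)
  set τ₀ := kpOmega ξ (c₀ - m) + θ with hτ₀
  calc _ ≤ ∫⁻ w in resonantSet R ξ m σ,
        ENNReal.ofReal (|w⁻¹| * (|ξ - m / w| * |m / w|)) *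
          E (ξ, c₀ - m, τ₀ + resonanceAt σ ξ m w) := by
        rw [← lintegral_indicator (measurableSet_resonantSet R ξ m σ)]
        refine lintegral_mono fun w => ?_
        by_cases hq : (ξ - m / w, 2 * σ * ξ + β - w, m / w) ∈ G
        swap
        · simp [hq]
        rw [Set.indicator_of_mem hq]
        obtain ⟨h1, h2, h3, -, -⟩ := hq
        simp only at h1 h2 h3
        have hw : w ≠ 0 := fun h => h3 (by simp [h])
        have hw' : w ∈ resonantSet R ξ m σ := by
          refine ⟨hw, ?_, h2⟩
          rw [show β - (2 * σ * ξ + β - w) = w - 2 * σ * ξ by ring] at h1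
          exact h1
        rw [Set.indicator_of_mem hw', hΨ]
        have hsum : ξ - m / w + m / w = ξ := sub_add_cancel _ _
        have hμ : σ * (ξ - m / w) ^ 2 + β * (ξ - m / w) +
            (-σ * (m / w) ^ 2 + (2 * σ * ξ + β - w) * (m / w)) = c₀ - m := by
          rw [hc₀]; field_simp; ring
        have hω := kpOmega_resonant hσ (β := β) (y := 2 * σ * ξ + β - w) hsum hξ0
        rw [hμ] at hω
        have hres : (ξ - m / w) * (m / w) / ξ * (β - (2 * σ * ξ + β - w)) *
            (β - (2 * σ * ξ + β - w) + 2 * σ * ξ) = resonanceAt σ ξ m w := by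
          unfold resonanceAt; field_simp; ring
        simp only
        rw [hω, hμ, hres, hsum, ← mul_assoc, ← ENNReal.ofReal_mul (abs_nonneg _), hτ₀,
          add_right_comm]
    _ ≤ ENNReal.ofReal (2 / κ) * ∫⁻ t, E (ξ, c₀ - m, τ₀ + t) :=
        setLIntegral_resonanceAt_le hσ hR hκ hRξ hκξ hm0 fun t => E (ξ, c₀ - m, τ₀ + t)
    _ = _ := by
        congr 1
        exact lintegral_add_left_eq_self (fun t => E (ξ, c₀ - m, t)) τ₀

/-! ### Parabolic coordinates and the resonant interaction -/

/-- Coordinates `(θ, β, ξ)` with `μ = σ ξ² + β ξ` and `τ = ω(ξ, μ) + θ`. -/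
noncomputable def kpChart (σ θ β ξ : ℝ) : ℝ × ℝ × ℝ :=
  (ξ, σ * ξ ^ 2 + β * ξ, kpOmega ξ (σ * ξ ^ 2 + β * ξ) + θ)

/-- The coordinate `β` of `kpChart`. -/
noncomputable def kpSlope (σ : ℝ) (a : ℝ × ℝ × ℝ) : ℝ := a.2.1 / a.1 - σ * a.1

theorem kpSlope_kpChart {σ θ β ξ : ℝ} (hξ : ξ ≠ 0) : kpSlope σ (kpChart σ θ β ξ) = β := by
  unfold kpSlope kpChart
  field_simp
  ring

theorem measurable_kpSlope (σ : ℝ) : Measurable (kpSlope σ) := by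
  unfold kpSlope
  fun_prop

theorem measurable_kpChart (σ : ℝ) :
    Measurable fun p : ℝ × ℝ × ℝ => kpChart σ p.1 p.2.1 p.2.2 := by
  unfold kpChart kpOmega
  fun_prop

theorem lintegral_comp_kpChart (σ : ℝ) {F : ℝ × ℝ × ℝ → ℝ≥0∞} (hF : Measurable F) :
    ∫⁻ a, F a = ∫⁻ θ, ∫⁻ β, ∫⁻ ξ, ENNReal.ofReal |ξ| * F (kpChart σ θ β ξ) := by
  have hne : ∀ᵐ w : ℝ, w ≠ 0 := by simp [ae_iff]
  have hm := hF.comp (measurable_kpChart σ)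
  calc _ = ∫⁻ ξ, ∫⁻ μ, ∫⁻ τ, F (ξ, μ, τ) := by
        rw [Measure.volume_eq_prod, lintegral_prod _ hF.aemeasurable]
        refine lintegral_congr fun ξ => ?_
        rw [Measure.volume_eq_prod, lintegral_prod _ (by fun_prop)]
    _ = ∫⁻ ξ, ∫⁻ β, ∫⁻ θ, ENNReal.ofReal |ξ| * F (kpChart σ θ β ξ) := by
        refine lintegral_congr_ae (hne.mono fun ξ hξ => ?_)
        simp only
        rw [lintegral_comp_affine hξ (σ * ξ ^ 2)]
        refine lintegral_congr fun β => ?_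
        rw [lintegral_const_mul' _ _ ENNReal.ofReal_ne_top]
        congr 1
        rw [← lintegral_add_left_eq_self _ (kpOmega ξ (ξ * β + σ * ξ ^ 2))]
        refine lintegral_congr fun θ => ?_
        rw [kpChart, show ξ * β + σ * ξ ^ 2 = σ * ξ ^ 2 + β * ξ by ring]
    _ = ∫⁻ β, ∫⁻ θ, ∫⁻ ξ, ENNReal.ofReal |ξ| * F (kpChart σ θ β ξ) := by
        refine lintegral_lintegral_lintegral_rotate
          (f := fun ξ β θ => ENNReal.ofReal |ξ| * F (kpChart σ θ β ξ)) ?_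
        have := hm.comp (by fun_prop : Measurable fun p : ℝ × ℝ × ℝ => (p.2.2, p.2.1, p.1))
        exact Measurable.mul (by fun_prop) this
    _ = _ := by
        rw [lintegral_lintegral_swap]
        have := hm.comp
          (by fun_prop : Measurable fun p : (ℝ × ℝ) × ℝ => (p.1.2, p.1.1, p.2))
        exact (Measurable.mul (f := fun p : (ℝ × ℝ) × ℝ => ENNReal.ofReal |p.2|)
          (by fun_prop) this).lintegral_prod_right'.aemeasurable

/-- The inner integral of the resonant interaction, at fixed coordinates `θ`, `β` of
the first frequency. -/
theorem lintegral_kpChart_resonant_le {σ R κ J₂ : ℝ} (hσ : σ ^ 2 = 3) (hR : 0 < R) (hκ : 0 < κ)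
    (θ β : ℝ) {E : ℝ × ℝ × ℝ → ℝ≥0∞} (hE : Measurable E)
    (sE : ∀ x, E x ≠ 0 → κ ≤ |x.1| ∧ R ≤ |x.1|)
    {D₂ : Set (ℝ × ℝ × ℝ)} (hD₂ : MeasurableSet D₂)
    (sD₂ : ∀ x ∈ D₂, x.1 ≠ 0 ∧ |x.2.2 - kpOmega x.1 x.2.1| ≤ J₂) :
    ∫⁻ ξ, ∫⁻ b, {ξ : ℝ | R ≤ |ξ|}.indicator (fun ξ => ENNReal.ofReal |ξ|) ξ *
      ({b | b ∈ D₂ ∧ |β - kpSlope (-σ) b| ≤ R}.indicator 1 b * E (kpChart σ θ β ξ + b)) ≤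
      ENNReal.ofReal (2 * J₂) * ENNReal.ofReal (2 / κ) * ∫⁻ x, E x := by
  set S := {b | b ∈ D₂ ∧ |β - kpSlope (-σ) b| ≤ R} with hS
  have mslope := measurable_kpSlope (-σ)
  have hSm : MeasurableSet S :=
    hD₂.inter (measurableSet_le (f := fun b => |β - kpSlope (-σ) b|) (by fun_prop) measurable_const)
  have hindm : Measurable (S.indicator (1 : ℝ × ℝ × ℝ → ℝ≥0∞)) := measurable_one.indicator hSm
  have hRm : Measurable ({ξ : ℝ | R ≤ |ξ|}.indicator (fun ξ => ENNReal.ofReal |ξ|)) :=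
    Measurable.indicator (by fun_prop) (measurableSet_le measurable_const (by fun_prop))
  set Ψ : ℝ → ℝ × ℝ × ℝ → ℝ≥0∞ := fun θ₂ => (resonantRegion β R κ).indicator
    (fun q => ENNReal.ofReal (|q.1| * |q.2.2|) *
      E (q.1 + q.2.2, (σ * q.1 ^ 2 + β * q.1) + (-σ * q.2.2 ^ 2 + q.2.1 * q.2.2),
        kpOmega q.1 (σ * q.1 ^ 2 + β * q.1) + kpOmega q.2.2 (-σ * q.2.2 ^ 2 + q.2.1 * q.2.2) +
          (θ + θ₂))) with hΨ
  have hΨm : Measurable fun p : ℝ × (ℝ × ℝ × ℝ) => Ψ p.1 p.2 := by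
    have h : (fun p : ℝ × (ℝ × ℝ × ℝ) => Ψ p.1 p.2) =
        (Prod.snd ⁻¹' (resonantRegion β R κ)).indicator (fun p =>
          ENNReal.ofReal (|p.2.1| * |p.2.2.2|) *
            E (p.2.1 + p.2.2.2, (σ * p.2.1 ^ 2 + β * p.2.1) +
              (-σ * p.2.2.2 ^ 2 + p.2.2.1 * p.2.2.2),
              kpOmega p.2.1 (σ * p.2.1 ^ 2 + β * p.2.1) +
              kpOmega p.2.2.2 (-σ * p.2.2.2 ^ 2 + p.2.2.1 * p.2.2.2) + (θ + p.1))) := rfl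
    rw [h]
    refine Measurable.indicator ?_ (measurable_snd (measurableSet_resonantRegion β R κ))
    unfold kpOmega
    fun_prop
  have mchart : Measurable fun ξ => kpChart σ θ β ξ :=
    (measurable_kpChart σ).comp (by fun_prop : Measurable fun ξ : ℝ => (θ, β, ξ))
  calc _ = ∫⁻ ξ, ∫⁻ θ₂, ∫⁻ β₂, ∫⁻ ξ₂, ENNReal.ofReal |ξ₂| *
        ({ξ : ℝ | R ≤ |ξ|}.indicator (fun ξ => ENNReal.ofReal |ξ|) ξ *
        (S.indicator 1 (kpChart (-σ) θ₂ β₂ ξ₂) *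
          E (kpChart σ θ β ξ + kpChart (-σ) θ₂ β₂ ξ₂))) := by
        refine lintegral_congr fun ξ => ?_
        rw [← lintegral_comp_kpChart (-σ) (F := fun b =>
          {ξ : ℝ | R ≤ |ξ|}.indicator (fun ξ => ENNReal.ofReal |ξ|) ξ *
            (S.indicator 1 b * E (kpChart σ θ β ξ + b)))]
        have : Measurable fun b => E (kpChart σ θ β ξ + b) := hE.comp (measurable_const_add _)
        fun_prop
    _ ≤ ∫⁻ ξ, ∫⁻ θ₂, ∫⁻ β₂, ∫⁻ ξ₂, (Set.Icc (-J₂) J₂).indicator 1 θ₂ * Ψ θ₂ (ξ, β₂, ξ₂) := by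
        refine lintegral_mono fun ξ => lintegral_mono fun θ₂ => lintegral_mono fun β₂ =>
          lintegral_mono fun ξ₂ => ?_
        by_cases h1 : R ≤ |ξ|
        swap
        · simp [h1]
        by_cases h2 : kpChart (-σ) θ₂ β₂ ξ₂ ∈ S
        swap
        · simp [h2]
        by_cases h3 : E (kpChart σ θ β ξ + kpChart (-σ) θ₂ β₂ ξ₂) = 0
        · simp [h3]
        obtain ⟨h4, h5⟩ := sD₂ _ h2.1
        obtain ⟨h6, h7⟩ := sE _ h3
        have h8 := h2.2
        have hξ₂ : ξ₂ ≠ 0 := h4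
        rw [kpSlope_kpChart hξ₂] at h8
        have hθ : θ₂ ∈ Set.Icc (-J₂) J₂ := abs_le.1 (by simpa [kpChart] using h5)
        have hq : (ξ, β₂, ξ₂) ∈ resonantRegion β R κ := ⟨h8, h1, hξ₂, h7, h6⟩
        rw [Set.indicator_of_mem hθ, Set.indicator_of_mem h2, hΨ]
        simp only
        rw [Set.indicator_of_mem hq, Set.indicator_of_mem (show ξ ∈ {ξ : ℝ | R ≤ |ξ|} from h1),
          ENNReal.ofReal_mul (abs_nonneg _), Pi.one_apply, Pi.one_apply, one_mul, one_mul,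
          ← mul_assoc, mul_comm (ENNReal.ofReal |ξ₂|)]
        refine le_of_eq ?_
        congr 2
        unfold kpChart
        simp only [Prod.mk_add_mk]
        congr 2
        ring
    _ = ∫⁻ θ₂, (Set.Icc (-J₂) J₂).indicator 1 θ₂ * ∫⁻ ξ, ∫⁻ β₂, ∫⁻ ξ₂, Ψ θ₂ (ξ, β₂, ξ₂) := by
        have hone : ∀ θ₂, (Set.Icc (-J₂) J₂).indicator (1 : ℝ → ℝ≥0∞) θ₂ ≠ ∞ := fun θ₂ => by
          by_cases h : θ₂ ∈ Set.Icc (-J₂) J₂ <;> simp [h]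
        rw [lintegral_lintegral_swap]
        · refine lintegral_congr fun θ₂ => ?_
          simp only [lintegral_const_mul' _ _ (hone θ₂)]
        · have hi : Measurable ((Set.Icc (-J₂) J₂).indicator (1 : ℝ → ℝ≥0∞)) :=
            measurable_one.indicator measurableSet_Icc
          have h0 : Measurable fun p : (((ℝ × ℝ) × ℝ) × ℝ) =>
              (Set.Icc (-J₂) J₂).indicator 1 p.1.1.2 * Ψ p.1.1.2 (p.1.1.1, p.1.2, p.2) := by
            have := hΨm.comp (by fun_prop : Measurable fun p : (((ℝ × ℝ) × ℝ) × ℝ) =>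
              (p.1.1.2, (p.1.1.1, p.1.2, p.2)))
            simp only [Function.comp_def] at this
            fun_prop
          exact h0.lintegral_prod_right'.lintegral_prod_right'.aemeasurable
    _ ≤ ∫⁻ θ₂, (Set.Icc (-J₂) J₂).indicator 1 θ₂ *
        (ENNReal.ofReal (2 / κ) * ∫⁻ x, E x) := by
        refine lintegral_mono fun θ₂ => ?_
        gcongr
        exact lintegral_resonantRegion_le hσ hR hκ β (θ + θ₂) hE
    _ = _ := by
        rw [lintegral_mul_const _ (measurable_one.indicator measurableSet_Icc),
          lintegral_indicator_one measurableSet_Icc, Real.volume_Icc, mul_assoc]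
        congr 2
        ring

/-- Cauchy–Schwarz is used twice. At fixed `θ`, `β` of the first point it separates `F₁`, `F₂` from
`F₃`, and the `F₃` part is the integral bounded above. Then in `(θ, β)`: `θ` ranges over length `2
J₁`, and each `b` meets labels `β` in an interval of length `2 R`. -/
theorem sq_lintegral_resonant_le {σ R κ J₁ J₂ : ℝ} (hσ : σ ^ 2 = 3) (hR : 0 < R) (hκ : 0 < κ)
    {F₁ F₂ F₃ : ℝ × ℝ × ℝ → ℝ≥0∞} (h₁ : Measurable F₁) (h₂ : Measurable F₂) (h₃ : Measurable F₃)
    (s₁ : ∀ x, F₁ x ≠ 0 → R ≤ |x.1| ∧ |x.2.2 - kpOmega x.1 x.2.1| ≤ J₁)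
    (s₂ : ∀ x, F₂ x ≠ 0 → x.1 ≠ 0 ∧ |x.2.2 - kpOmega x.1 x.2.1| ≤ J₂)
    (s₃ : ∀ x, F₃ x ≠ 0 → κ ≤ |x.1| ∧ R ≤ |x.1|) :
    (∫⁻ a, ∫⁻ b, {p : (ℝ × ℝ × ℝ) × (ℝ × ℝ × ℝ) | |kpSlope σ p.1 - kpSlope (-σ) p.2| ≤ R}.indicator
        (fun p => F₁ p.1 * F₂ p.2 * F₃ (-(p.1 + p.2))) (a, b)) ^ 2 ≤
      ENNReal.ofReal (2 * J₂) * ENNReal.ofReal (2 / κ) * ENNReal.ofReal (2 * J₁) *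
        ENNReal.ofReal (2 * R) *
        (∫⁻ x, F₁ x ^ 2) * (∫⁻ x, F₂ x ^ 2) * ∫⁻ x, F₃ x ^ 2 := by
  set W := {p : (ℝ × ℝ × ℝ) × (ℝ × ℝ × ℝ) | |kpSlope σ p.1 - kpSlope (-σ) p.2| ≤ R} with hW
  have ms₁ := measurable_kpSlope σ
  have ms₂ := measurable_kpSlope (-σ)
  have hWm : MeasurableSet W :=
    measurableSet_le (f := fun p : (ℝ × ℝ × ℝ) × (ℝ × ℝ × ℝ) =>
      |kpSlope σ p.1 - kpSlope (-σ) p.2|) (by fun_prop) measurable_const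
  have hF₃' : Measurable fun p : (ℝ × ℝ × ℝ) × (ℝ × ℝ × ℝ) => F₃ (-(p.1 + p.2)) :=
    h₃.comp (by fun_prop :
      Measurable fun p : (ℝ × ℝ × ℝ) × (ℝ × ℝ × ℝ) =>
        (-(p.1.1 + p.2.1), -(p.1.2.1 + p.2.2.1), -(p.1.2.2 + p.2.2.2)))
  set D₂ : Set (ℝ × ℝ × ℝ) := {x | F₂ x ≠ 0} with hD₂
  have hD₂m : MeasurableSet D₂ := h₂ (measurableSet_singleton 0).compl
  -- An idempotent cutoff, so it can stand in both Cauchy–Schwarz factors; it keeps the support of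
  -- `F₂` in the factor that contains only `F₃`.
  set χ : ℝ → ℝ × ℝ × ℝ → ℝ≥0∞ := fun β =>
    {b | b ∈ D₂ ∧ |β - kpSlope (-σ) b| ≤ R}.indicator 1 with hχ
  have hχm : Measurable fun p : ℝ × (ℝ × ℝ × ℝ) => χ p.1 p.2 := by
    have : (fun p : ℝ × (ℝ × ℝ × ℝ) => χ p.1 p.2) = ((Prod.snd ⁻¹' D₂) ∩
        {p : ℝ × (ℝ × ℝ × ℝ) | |p.1 - kpSlope (-σ) p.2| ≤ R}).indicator 1 := rfl
    rw [this]
    exact measurable_one.indicator ((measurable_snd hD₂m).inter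
      (measurableSet_le (by fun_prop) measurable_const))
  have hχsq : ∀ β b, χ β b ^ 2 = χ β b := fun β b => by
    rw [hχ]
    by_cases h : b ∈ {b | b ∈ D₂ ∧ |β - kpSlope (-σ) b| ≤ R} <;> simp [h]
  -- The square root of the Jacobian `|ξ|`, to be shared equally between the two factors.
  set s : ℝ → ℝ≥0∞ :=
    {ξ : ℝ | R ≤ |ξ|}.indicator (fun ξ => ENNReal.ofReal |ξ| ^ (1 / 2 : ℝ)) with hs
  have hsm : Measurable s :=
    Measurable.indicator (by fun_prop) (measurableSet_le measurable_const (by fun_prop))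
  have hssq : ∀ ξ, s ξ ^ 2 = {ξ : ℝ | R ≤ |ξ|}.indicator (fun ξ => ENNReal.ofReal |ξ|) ξ :=
    fun ξ => by
      by_cases h : R ≤ |ξ|
      · simp only [hs, Set.indicator_of_mem (show ξ ∈ {ξ : ℝ | R ≤ |ξ|} from h), ENNReal.sqrt_sq]
      · simp [hs, h]
  have mchart : ∀ θ β, Measurable fun ξ => kpChart σ θ β ξ := fun θ β =>
    (measurable_kpChart σ).comp (by fun_prop : Measurable fun ξ : ℝ => (θ, β, ξ))
  set A : ℝ → ℝ → ℝ≥0∞ := fun θ β => ∫⁻ ξ, ENNReal.ofReal |ξ| * F₁ (kpChart σ θ β ξ) ^ 2 with hA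
  have hAm : Measurable fun p : ℝ × ℝ => A p.1 p.2 := by
    have := (h₁.comp (measurable_kpChart σ)).comp
      (by fun_prop : Measurable fun p : (ℝ × ℝ) × ℝ => (p.1.1, p.1.2, p.2))
    exact (Measurable.mul (f := fun p : (ℝ × ℝ) × ℝ => ENNReal.ofReal |p.2|)
          (by fun_prop) (this.pow_const 2)).lintegral_prod_right'
  set B : ℝ → ℝ≥0∞ := fun β => ∫⁻ b, F₂ b ^ 2 * χ β b with hB
  have hBm : Measurable B :=
    (Measurable.mul (f := fun p : ℝ × (ℝ × ℝ × ℝ) => F₂ p.2 ^ 2)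
      (by fun_prop) hχm).lintegral_prod_right'
  set Q := ENNReal.ofReal (2 * J₂) * ENNReal.ofReal (2 / κ) * ∫⁻ x, F₃ x ^ 2 with hQ
  set ι : ℝ → ℝ≥0∞ := (Set.Icc (-J₁) J₁).indicator 1 with hι
  have hιm : Measurable ι := measurable_one.indicator measurableSet_Icc
  have hιsq : ∀ θ, ι θ ^ 2 = ι θ := fun θ => by
    by_cases h : θ ∈ Set.Icc (-J₁) J₁ <;> simp [hι, h]
  -- the inner integral
  have inner : ∀ θ β, ∫⁻ ξ, ENNReal.ofReal |ξ| * ∫⁻ b, W.indicator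
      (fun p => F₁ p.1 * F₂ p.2 * F₃ (-(p.1 + p.2))) (kpChart σ θ β ξ, b) ≤
      Q ^ (1 / 2 : ℝ) * (A θ β ^ (1 / 2 : ℝ) * (ι θ * B β ^ (1 / 2 : ℝ))) := by
    intro θ β
    have mc := mchart θ β
    have mχ : Measurable (χ β) := hχm.comp (by fun_prop : Measurable fun b => (β, b))
    have mF₃ : Measurable fun p : ℝ × (ℝ × ℝ × ℝ) => F₃ (-(kpChart σ θ β p.1 + p.2)) :=
      hF₃'.comp ((mc.comp measurable_fst).prodMk measurable_snd)
    by_cases hθ : θ ∈ Set.Icc (-J₁) J₁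
    swap
    · have h0 : ∀ ξ, F₁ (kpChart σ θ β ξ) = 0 := fun ξ => not_not.1 fun h => hθ (abs_le.1 (by
        simpa [kpChart] using (s₁ _ h).2))
      refine (lintegral_eq_zero_of_ae_eq_zero (Filter.Eventually.of_forall fun ξ => ?_)).trans_le
        zero_le
      simp [Set.indicator, h0]
    have hιθ : ι θ = 1 := by simp [hι, hθ]
    have mX : Measurable fun p : ℝ × (ℝ × ℝ × ℝ) =>
        (s p.1 * F₁ (kpChart σ θ β p.1)) * (F₂ p.2 * χ β p.2) := by fun_prop
    have mY : Measurable fun p : ℝ × (ℝ × ℝ × ℝ) =>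
        s p.1 * (χ β p.2 * F₃ (-(kpChart σ θ β p.1 + p.2))) := by fun_prop
    calc _ = ∫⁻ ξ, ∫⁻ b, ((s ξ * F₁ (kpChart σ θ β ξ)) * (F₂ b * χ β b)) *
          (s ξ * (χ β b * F₃ (-(kpChart σ θ β ξ + b)))) := by
          refine lintegral_congr fun ξ => ?_
          rw [← lintegral_const_mul' _ _ ENNReal.ofReal_ne_top]
          refine lintegral_congr fun b => ?_
          by_cases z₁ : F₁ (kpChart σ θ β ξ) = 0
          · simp [Set.indicator, z₁]
          by_cases z₂ : F₂ b = 0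
          · simp [Set.indicator, z₂]
          have hξR : R ≤ |ξ| := (s₁ _ z₁).1
          have hξ0 : ξ ≠ 0 := abs_pos.1 (hR.trans_le hξR)
          have hsξ : s ξ * s ξ = ENNReal.ofReal |ξ| := by
            rw [← sq, hssq, Set.indicator_of_mem (show ξ ∈ {ξ : ℝ | R ≤ |ξ|} from hξR)]
          by_cases hb : |β - kpSlope (-σ) b| ≤ R
          · have hw : (kpChart σ θ β ξ, b) ∈ W := by
              show |kpSlope σ (kpChart σ θ β ξ) - kpSlope (-σ) b| ≤ R
              rwa [kpSlope_kpChart hξ0]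
            have hc : χ β b = 1 := by
              rw [hχ]; exact Set.indicator_of_mem (show b ∈ {b | b ∈ D₂ ∧ _} from ⟨z₂, hb⟩) _
            rw [Set.indicator_of_mem hw, hc, ← hsξ]
            ring
          · have hw : (kpChart σ θ β ξ, b) ∉ W := by
              show ¬ |kpSlope σ (kpChart σ θ β ξ) - kpSlope (-σ) b| ≤ R
              rwa [kpSlope_kpChart hξ0]
            have hc : χ β b = 0 := by
              rw [hχ]; exact Set.indicator_of_notMem (fun h => hb h.2) _
            rw [Set.indicator_of_notMem hw, hc]
            ring
      _ = ∫⁻ p : ℝ × (ℝ × ℝ × ℝ), ((s p.1 * F₁ (kpChart σ θ β p.1)) * (F₂ p.2 * χ β p.2)) *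
          (s p.1 * (χ β p.2 * F₃ (-(kpChart σ θ β p.1 + p.2)))) :=
          (lintegral_prod _ (mX.mul mY).aemeasurable).symm
      _ ≤ (Q * (A θ β * B β)) ^ (1 / 2 : ℝ) := by
          refine ENNReal.le_sqrt_of_sq_le ((sq_lintegral_mul_le mX.aemeasurable
            mY.aemeasurable).trans ?_)
          rw [mul_comm Q]
          refine mul_le_mul' ?_ ?_
          · simp only [mul_pow, hχsq, hssq]
            refine (lintegral_prod_mul (μ := volume) (ν := volume)
              (f := fun ξ => {ξ : ℝ | R ≤ |ξ|}.indicator (fun ξ => ENNReal.ofReal |ξ|) ξ *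
                F₁ (kpChart σ θ β ξ) ^ 2) (g := fun b => F₂ b ^ 2 * χ β b)
              ?_ (by fun_prop)).trans_le ?_
            · simp only [← hssq]
              fun_prop
            · exact mul_le_mul' (lintegral_mono fun ξ => mul_le_mul'
                (Set.indicator_le_self {ξ : ℝ | R ≤ |ξ|} (fun ξ => ENNReal.ofReal |ξ|) ξ)
                le_rfl) le_rfl
          · have e : ∫⁻ x, F₃ x ^ 2 = ∫⁻ x, F₃ (-x) ^ 2 :=
              (lintegral_neg_eq_self (fun x => F₃ x ^ 2)).symm
            rw [hQ, e]
            refine le_trans ?_ (lintegral_kpChart_resonant_le hσ hR hκ θ β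
              (E := fun x => F₃ (-x) ^ 2) (by fun_prop) (fun x hx => ?_) hD₂m (fun x hx => s₂ x hx))
            · refine (lintegral_prod _ (mY.pow_const 2).aemeasurable).trans_le ?_
              simp only [mul_pow, hχsq, hssq]
              exact le_rfl
            · have := s₃ (-x) (fun h => hx (by simp [h]))
              simpa using this
      _ = _ := by
          rw [hιθ, one_mul, ENNReal.mul_rpow_of_nonneg Q _ (by norm_num),
            ENNReal.mul_rpow_of_nonneg (A θ β) _ (by norm_num)]
  -- the outer integral
  have hIm : Measurable fun a => ∫⁻ b, W.indicator
      (fun p => F₁ p.1 * F₂ p.2 * F₃ (-(p.1 + p.2))) (a, b) :=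
    (Measurable.indicator (by fun_prop) hWm).lintegral_prod_right'
  have hN₁ : ∫⁻ x, F₁ x ^ 2 = ∫⁻ θ, ∫⁻ β, A θ β :=
    lintegral_comp_kpChart σ (F := fun x => F₁ x ^ 2) (by fun_prop)
  have hN₂ : ∫⁻ β, B β ≤ ENNReal.ofReal (2 * R) * ∫⁻ x, F₂ x ^ 2 := by
    rw [hB, lintegral_lintegral_swap
      (Measurable.mul (f := fun p : ℝ × (ℝ × ℝ × ℝ) => F₂ p.2 ^ 2)
        (by fun_prop) hχm).aemeasurable, ← lintegral_const_mul' _ _ ENNReal.ofReal_ne_top]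
    refine lintegral_mono fun b => ?_
    have mχ : Measurable fun β => χ β b :=
      hχm.comp (by fun_prop : Measurable fun β : ℝ => (β, b))
    rw [lintegral_const_mul _ mχ, mul_comm]
    gcongr
    calc _ ≤ ∫⁻ β, (Set.Icc (kpSlope (-σ) b - R) (kpSlope (-σ) b + R)).indicator 1 β := by
          refine lintegral_mono fun β => ?_
          by_cases h : b ∈ {b | b ∈ D₂ ∧ |β - kpSlope (-σ) b| ≤ R}
          · have h' : β ∈ Set.Icc (kpSlope (-σ) b - R) (kpSlope (-σ) b + R) :=
              Set.mem_Icc_iff_abs_le.1 (by rw [abs_sub_comm]; exact h.2)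
            rw [Set.indicator_of_mem h']
            exact Set.indicator_apply_le fun _ => le_rfl
          · rw [hχ]
            simp only
            rw [Set.indicator_of_notMem h]
            exact zero_le
      _ = _ := by
          rw [lintegral_indicator_one measurableSet_Icc, Real.volume_Icc]
          congr 1
          ring
  have mA : Measurable fun p : ℝ × ℝ => A p.1 p.2 ^ (1 / 2 : ℝ) := hAm.pow_const _
  have mB : Measurable fun p : ℝ × ℝ => ι p.1 * B p.2 ^ (1 / 2 : ℝ) :=
    (hιm.comp measurable_fst).mul ((hBm.comp measurable_snd).pow_const _)
  have mAB : Measurable fun p : ℝ × ℝ =>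
    A p.1 p.2 ^ (1 / 2 : ℝ) * (ι p.1 * B p.2 ^ (1 / 2 : ℝ)) := mA.mul mB
  clear_value A B
  have hfin : ∫⁻ a, ∫⁻ b, W.indicator (fun p => F₁ p.1 * F₂ p.2 * F₃ (-(p.1 + p.2))) (a, b) ≤
      Q ^ (1 / 2 : ℝ) * ∫⁻ p : ℝ × ℝ, A p.1 p.2 ^ (1 / 2 : ℝ) * (ι p.1 * B p.2 ^ (1 / 2 : ℝ)) := by
    rw [lintegral_comp_kpChart σ hIm, ← lintegral_const_mul _ mAB]
    refine le_trans ?_ (lintegral_prod _ (mAB.const_mul _).aemeasurable).ge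
    exact lintegral_mono fun θ => lintegral_mono fun β => inner θ β
  calc _ ≤ _ := pow_le_pow_left' hfin 2
    _ ≤ Q * ((∫⁻ p : ℝ × ℝ, A p.1 p.2) * ∫⁻ p : ℝ × ℝ, ι p.1 * B p.2) := by
        rw [mul_pow, ENNReal.sqrt_sq]
        gcongr
        refine (sq_lintegral_mul_le mA.aemeasurable mB.aemeasurable).trans_eq ?_
        simp only [mul_pow, ENNReal.sqrt_sq, hιsq]
    _ ≤ Q * ((∫⁻ x, F₁ x ^ 2) * (ENNReal.ofReal (2 * J₁) *
          (ENNReal.ofReal (2 * R) * ∫⁻ x, F₂ x ^ 2))) := by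
        gcongr Q * (?_ * ?_)
        · rw [hN₁]
          exact (lintegral_prod _ hAm.aemeasurable).le
        · refine (lintegral_prod_mul (μ := volume) (ν := volume) hιm.aemeasurable
            hBm.aemeasurable).trans_le (mul_le_mul' (le_of_eq ?_) hN₂)
          rw [hι, lintegral_indicator_one measurableSet_Icc, Real.volume_Icc]
          congr 1
          ring
    _ = _ := by
        rw [hQ]
        ring

/-- If the resonance function is small, one of the two factors of it is small. -/
theorem abs_kpSlope_sub_le_or {J R : ℝ} {a b : ℝ × ℝ × ℝ} (ha : a.1 ≠ 0) (hb : b.1 ≠ 0)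
    (hab : a.1 + b.1 ≠ 0) (hR : 3 * J ≤ R * (|a.1| * |b.1|)) (h₁ : |a.2.2 - kpOmega a.1 a.2.1| ≤ J)
    (h₂ : |b.2.2 - kpOmega b.1 b.2.1| ≤ J)
    (h₃ : |(a.2.2 + b.2.2) - kpOmega (a.1 + b.1) (a.2.1 + b.2.1)| ≤ J) :
    |kpSlope (√3) a - kpSlope (-√3) b| ≤ R ∨ |kpSlope (-√3) a - kpSlope (√3) b| ≤ R := by
  set p := kpSlope (√3) a - kpSlope (-√3) b with hp
  set q := kpSlope (-√3) a - kpSlope (√3) b with hq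
  have h3 : √3 ^ 2 = 3 := Real.sq_sqrt (by norm_num)
  have hid : kpOmega a.1 a.2.1 + kpOmega b.1 b.2.1 - kpOmega (a.1 + b.1) (a.2.1 + b.2.1) =
      a.1 * b.1 / (a.1 + b.1) * (p * q) := by
    have : p * q = (a.2.1 / a.1 - b.2.1 / b.1) ^ 2 - 3 * (a.1 + b.1) ^ 2 := by
      rw [hp, hq]; unfold kpSlope
      linear_combination (-(a.1 + b.1) ^ 2) * h3
    rw [this]
    unfold kpOmega
    field_simp
    ring
  have hΩ : |a.1 * b.1 / (a.1 + b.1) * (p * q)| ≤ 3 * J := by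
    rw [← hid]
    calc _ = |((a.2.2 + b.2.2) - kpOmega (a.1 + b.1) (a.2.1 + b.2.1)) -
          (a.2.2 - kpOmega a.1 a.2.1) - (b.2.2 - kpOmega b.1 b.2.1)| := by congr 1; ring
      _ ≤ |(a.2.2 + b.2.2) - kpOmega (a.1 + b.1) (a.2.1 + b.2.1)| +
          |a.2.2 - kpOmega a.1 a.2.1| + |b.2.2 - kpOmega b.1 b.2.1| :=
          (abs_sub _ _).trans (add_le_add_left (abs_sub _ _) _)
      _ ≤ _ := by linarith
  have hpos : 0 < |a.1| * |b.1| := by positivity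
  have hsum : 0 < |a.1 + b.1| := by positivity
  have hpq : |p| * |q| ≤ R * |a.1 + b.1| := by
    rw [abs_mul, abs_div, abs_mul, abs_mul, div_mul_eq_mul_div, div_le_iff₀ hsum] at hΩ
    have : |a.1| * |b.1| * (|p| * |q|) ≤ |a.1| * |b.1| * (R * |a.1 + b.1|) := by
      refine hΩ.trans ?_
      calc _ ≤ R * (|a.1| * |b.1|) * |a.1 + b.1| := by gcongr
        _ = _ := by ring
    exact le_of_mul_le_mul_left this hpos
  -- The two factors differ by `2√3(ξ₁+ξ₂)`, so the larger is at least `|ξ₁+ξ₂|`; the bound `hpq`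
  -- then forces the smaller one below `R`.
  have hdiff : 2 * |a.1 + b.1| ≤ |p| + |q| := by
    have e : q - p = 2 * √3 * (a.1 + b.1) := by
      rw [hp, hq]; unfold kpSlope; ring
    have := abs_sub q p
    rw [e, abs_mul, abs_mul, abs_two] at this
    have h1 : 1 ≤ |√3| := one_le_abs_of_sq_eq_three h3
    nlinarith
  by_contra! h
  rcases le_total |p| |q| with hle | hle
  · have : |a.1 + b.1| ≤ |q| := by linarith
    nlinarith [abs_nonneg p]
  · have : |a.1 + b.1| ≤ |p| := by linarith
    nlinarith [abs_nonneg q]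

/-- The resonant interaction, with the largest modulation in the third factor. -/
theorem sq_trilinearForm_le_resonant {k₁ k₂ k₃ : ℤ} {j₁ j₂ j₃ : ℕ}
    {F₁ F₂ F₃ : ℝ × ℝ × ℝ → ℝ≥0∞} (h₁ : Measurable F₁) (h₂ : Measurable F₂) (h₃ : Measurable F₃)
    (s₁ : ∀ x, F₁ x ≠ 0 → x ∈ kpRegionTop k₁ j₁) (s₂ : ∀ x, F₂ x ≠ 0 → x ∈ kpRegionTop k₂ j₂)
    (s₃ : ∀ x, F₃ x ≠ 0 → x ∈ kpRegionTop k₃ j₃) (hj₁ : j₁ ≤ j₃) (hj₂ : j₂ ≤ j₃) (hk : k₂ ≤ k₁)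
    (hres : (2 : ℝ) ^ 10 * 2 ^ j₃ ≤ 2 ^ (k₁ + k₂ + k₃)) :
    trilinearForm F₁ F₂ F₃ ^ 2 ≤
      ENNReal.ofReal (1536 * (2 ^ j₁ * 2 ^ j₂ * 2 ^ j₃) / 2 ^ (k₁ + k₂ + k₃)) *
        (∫⁻ x, F₁ x ^ 2) * (∫⁻ x, F₂ x ^ 2) * ∫⁻ x, F₃ x ^ 2 := by
  simp only [mem_kpRegionTop_iff] at s₁ s₂ s₃
  have two0 : (2 : ℝ) ≠ 0 := two_ne_zero
  rw [zpow_add₀ two0, zpow_add₀ two0] at hres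
  set x₁ : ℝ := 2 ^ k₁ with hx₁
  set x₂ : ℝ := 2 ^ k₂ with hx₂
  set x₃ : ℝ := 2 ^ k₃ with hx₃
  have px₁ : 0 < x₁ := by positivity
  have px₂ : 0 < x₂ := by positivity
  have px₃ : 0 < x₃ := by positivity
  have hx₂₁ : x₂ ≤ x₁ := zpow_le_zpow_right₀ (by norm_num) hk
  have shell : ∀ (k : ℤ) (ξ : ℝ), ξ ∈ dyadicShell k → 2 ^ k / 2 ≤ |ξ| ∧ |ξ| ≤ 2 * 2 ^ k := by
    intro k ξ h
    obtain ⟨l, u⟩ := h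
    rw [zpow_sub_one₀ two0] at l
    rw [zpow_add_one₀ two0] at u
    constructor <;> linarith
  set J : ℝ := 2 ^ j₃ with hJ
  have pJ : 0 < J := by positivity
  have hJ₁ : (2 : ℝ) ^ j₁ ≤ J := pow_le_pow_right₀ (by norm_num) hj₁
  have hJ₂ : (2 : ℝ) ^ j₂ ≤ J := pow_le_pow_right₀ (by norm_num) hj₂
  -- The shells give `|ξ₁||ξ₂| ≥ x₁x₂/4`, so 12 makes `R|ξ₁||ξ₂|` at least `3J`, the bound for the
  -- resonance function.
  set R : ℝ := 12 * J / (x₁ * x₂) with hR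
  have pR : 0 < R := by positivity
  have hRx₃ : R ≤ x₃ / 64 := by
    rw [hR, div_le_iff₀ (by positivity)]
    nlinarith
  -- the geometry of an interaction
  have geom : ∀ a b, F₁ a * F₂ b * F₃ (-(a + b)) ≠ 0 → x₃ ≤ 8 * x₁ ∧
      (|kpSlope (√3) a - kpSlope (-√3) b| ≤ R ∨ |kpSlope (-√3) a - kpSlope (√3) b| ≤ R) := by
    intro a b h
    obtain ⟨da, ma⟩ := s₁ a (left_ne_zero_of_mul (left_ne_zero_of_mul h))
    obtain ⟨db, mb⟩ := s₂ b (right_ne_zero_of_mul (left_ne_zero_of_mul h))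
    obtain ⟨dc, mc⟩ := s₃ _ (right_ne_zero_of_mul h)
    simp only [Prod.fst_neg, Prod.snd_neg, kpOmega_neg, neg_sub_neg, Prod.fst_add,
      Prod.snd_add] at dc mc
    rw [abs_sub_comm] at mc
    have la := shell _ _ da
    have lb := shell _ _ db
    have lc := shell _ _ dc
    rw [abs_neg] at lc
    refine ⟨?_, abs_kpSlope_sub_le_or (J := J) (abs_pos.1 (pos_of_mem_dyadicShell da))
      (abs_pos.1 (pos_of_mem_dyadicShell db)) ?_ ?_ (ma.trans hJ₁) (mb.trans hJ₂) mc⟩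
    · have := abs_add_le a.1 b.1
      linarith [la.2, lb.2, lc.1]
    · exact abs_pos.1 (lt_of_lt_of_le (by positivity) lc.1)
    · calc 3 * J = R * (x₁ / 2 * (x₂ / 2)) := by rw [hR]; field_simp; norm_num
        _ ≤ _ := by
          gcongr
          · exact la.1
          · exact lb.1
  by_cases hx : x₃ ≤ 8 * x₁
  swap
  · have h0 : trilinearForm F₁ F₂ F₃ = 0 := by
      unfold trilinearForm
      have : ∀ a b, F₁ a * F₂ b * F₃ (-(a + b)) = 0 := fun a b =>
        not_not.1 fun h => hx (geom a b h).1
      simp only [this, lintegral_zero]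
    rw [h0]
    simp
  have hRx₁ : R ≤ x₁ / 2 := by linarith
  -- The two alternatives of `geom` are the same estimate with `σ = √3` and `σ = -√3`.
  have bound : ∀ σ : ℝ, σ ^ 2 = 3 → _ := fun σ hσ =>
    sq_lintegral_resonant_le (σ := σ) (R := R) (κ := x₃ / 2) (J₁ := 2 ^ j₁) (J₂ := 2 ^ j₂) hσ pR
      (by positivity) h₁ h₂ h₃
      (fun x hx => ⟨hRx₁.trans (shell _ _ (s₁ x hx).1).1, (s₁ x hx).2⟩)
      (fun x hx => ⟨abs_pos.1 (pos_of_mem_dyadicShell (s₂ x hx).1), (s₂ x hx).2⟩)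
      (fun x hx => ⟨(shell _ _ (s₃ x hx).1).1,
        le_trans (by linarith) (shell _ _ (s₃ x hx).1).1⟩)
  have b₁ := bound (√3) (Real.sq_sqrt (by norm_num))
  have b₂ := bound (-√3) (by rw [neg_sq]; exact Real.sq_sqrt (by norm_num))
  rw [neg_neg] at b₂
  set W₁ := {p : (ℝ × ℝ × ℝ) × (ℝ × ℝ × ℝ) | |kpSlope (√3) p.1 - kpSlope (-√3) p.2| ≤ R} with hW₁
  set W₂ := {p : (ℝ × ℝ × ℝ) × (ℝ × ℝ × ℝ) | |kpSlope (-√3) p.1 - kpSlope (√3) p.2| ≤ R} with hW₂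
  set Φ : (ℝ × ℝ × ℝ) × (ℝ × ℝ × ℝ) → ℝ≥0∞ := fun p => F₁ p.1 * F₂ p.2 * F₃ (-(p.1 + p.2)) with hΦ
  have hΦm : Measurable Φ := by
    have : Measurable fun p : (ℝ × ℝ × ℝ) × (ℝ × ℝ × ℝ) => F₃ (-(p.1 + p.2)) :=
      h₃.comp (by fun_prop :
        Measurable fun p : (ℝ × ℝ × ℝ) × (ℝ × ℝ × ℝ) =>
          (-(p.1.1 + p.2.1), -(p.1.2.1 + p.2.2.1), -(p.1.2.2 + p.2.2.2)))
    rw [hΦ]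
    fun_prop
  have ms := measurable_kpSlope (√3)
  have ms' := measurable_kpSlope (-√3)
  have hW₁m : MeasurableSet W₁ := measurableSet_le (f := fun p : (ℝ × ℝ × ℝ) × (ℝ × ℝ × ℝ) =>
      |kpSlope (√3) p.1 - kpSlope (-√3) p.2|) (by fun_prop) measurable_const
  have hΦ₁ := hΦm.indicator hW₁m
  have split : trilinearForm F₁ F₂ F₃ ≤
      (∫⁻ a, ∫⁻ b, W₁.indicator Φ (a, b)) + ∫⁻ a, ∫⁻ b, W₂.indicator Φ (a, b) := by
    unfold trilinearForm
    rw [← lintegral_add_left hΦ₁.lintegral_prod_right']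
    refine lintegral_mono fun a => ?_
    rw [← lintegral_add_left (by fun_prop)]
    refine lintegral_mono fun b => ?_
    by_cases h : F₁ a * F₂ b * F₃ (-(a + b)) = 0
    · rw [h]; exact zero_le
    rcases (geom a b h).2 with h' | h'
    · rw [Set.indicator_of_mem (show (a, b) ∈ W₁ from h')]
      exact le_self_add
    · rw [Set.indicator_of_mem (show (a, b) ∈ W₂ from h')]
      exact le_add_self
  refine ((pow_le_pow_left' split 2).trans (ENNReal.add_sq_le _ _)).trans ?_
  refine (add_le_add (mul_le_mul_right b₁ 2) (mul_le_mul_right b₂ 2)).trans_eq ?_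
  -- The 4 comes from `(u + v)² ≤ 2u² + 2v²` with equal bounds for the two terms.
  have hconst : ENNReal.ofReal (1536 * (2 ^ j₁ * 2 ^ j₂ * J) / 2 ^ (k₁ + k₂ + k₃)) =
      4 * (ENNReal.ofReal (2 * 2 ^ j₂) * ENNReal.ofReal (2 / (x₃ / 2)) *
        ENNReal.ofReal (2 * 2 ^ j₁) * ENNReal.ofReal (2 * R)) := by
    rw [← ENNReal.ofReal_mul (by positivity), ← ENNReal.ofReal_mul (by positivity),
      ← ENNReal.ofReal_mul (by positivity), ← ENNReal.ofReal_ofNat 4,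
      ← ENNReal.ofReal_mul (by norm_num), zpow_add₀ two0, zpow_add₀ two0, hR]
    congr 1
    simp only [← hx₁, ← hx₂, ← hx₃]
    field_simp
    norm_num
  rw [hconst]
  ring

/-! ### The unweighted trilinear estimate -/

theorem modulation_le_of_mem_kpRegionTop {k : ℤ} {j : ℕ} {x : ℝ × ℝ × ℝ}
    (hx : x ∈ kpRegionTop k j) : x.1 ≠ 0 ∧ |x.2.2 - kpOmega x.1 x.2.1| ≤ 2 ^ j :=
  have h := mem_kpRegionTop_iff.1 hx
  ⟨abs_pos.1 (pos_of_mem_dyadicShell h.1), h.2⟩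

/-- When `2 ^ (k₁ + k₂ + k₃)` is below `2 ^ 10` times the top modulation, the denominator is at most
`1025 * 2 ^ j₃`, and Strichartz for `F₁`, `F₂` is enough. Otherwise the interaction is resonant, and
exchanging the first two factors arranges `k₂ ≤ k₁`. -/
theorem sq_trilinearForm_le_of_max_third {k₁ k₂ k₃ : ℤ} {j₁ j₂ j₃ : ℕ}
    {F₁ F₂ F₃ : ℝ × ℝ × ℝ → ℝ≥0∞} (h₁ : Measurable F₁) (h₂ : Measurable F₂) (h₃ : Measurable F₃)
    (s₁ : ∀ x, F₁ x ≠ 0 → x ∈ kpRegionTop k₁ j₁) (s₂ : ∀ x, F₂ x ≠ 0 → x ∈ kpRegionTop k₂ j₂)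
    (s₃ : ∀ x, F₃ x ≠ 0 → x ∈ kpRegionTop k₃ j₃) (hj₁ : j₁ ≤ j₃) (hj₂ : j₂ ≤ j₃) :
    trilinearForm F₁ F₂ F₃ ^ 2 ≤
      ENNReal.ofReal (10 ^ 6 * (2 ^ j₁ * 2 ^ j₂ * 2 ^ j₃) / (2 ^ j₃ + 2 ^ (k₁ + k₂ + k₃))) *
        (∫⁻ x, F₁ x ^ 2) * (∫⁻ x, F₂ x ^ 2) * ∫⁻ x, F₃ x ^ 2 := by
  have pK : (0 : ℝ) < 2 ^ (k₁ + k₂ + k₃) := by positivity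
  rcases le_or_gt ((2 : ℝ) ^ 10 * 2 ^ j₃) (2 ^ (k₁ + k₂ + k₃)) with hres | hres
  · have hc : ENNReal.ofReal (1536 * (2 ^ j₁ * 2 ^ j₂ * 2 ^ j₃) / 2 ^ (k₁ + k₂ + k₃)) ≤
        ENNReal.ofReal (10 ^ 6 * (2 ^ j₁ * 2 ^ j₂ * 2 ^ j₃) / (2 ^ j₃ + 2 ^ (k₁ + k₂ + k₃))) := by
      refine ENNReal.ofReal_le_ofReal ?_
      rw [div_le_div_iff₀ pK (by positivity)]
      have : (2 : ℝ) ^ j₃ ≤ 2 ^ (k₁ + k₂ + k₃) := by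
        have : (0 : ℝ) < 2 ^ j₃ := by positivity
        linarith
      calc _ ≤ 1536 * (2 ^ j₁ * 2 ^ j₂ * 2 ^ j₃) *
            ((2 : ℝ) ^ (k₁ + k₂ + k₃) + 2 ^ (k₁ + k₂ + k₃)) := by gcongr
        _ = 3072 * (2 ^ j₁ * 2 ^ j₂ * 2 ^ j₃) * (2 : ℝ) ^ (k₁ + k₂ + k₃) := by ring
        _ ≤ _ := by gcongr; norm_num
    rcases le_total k₂ k₁ with hk | hk
    · refine (sq_trilinearForm_le_resonant h₁ h₂ h₃ s₁ s₂ s₃ hj₁ hj₂ hk hres).trans ?_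
      gcongr
    · rw [trilinearForm_swap_left h₁ h₂ h₃]
      refine (sq_trilinearForm_le_resonant h₂ h₁ h₃ s₂ s₁ s₃ hj₂ hj₁ hk
        (by rwa [add_comm k₂])).trans ?_
      rw [add_comm k₂, mul_comm ((2 : ℝ) ^ j₂), mul_right_comm (ENNReal.ofReal _)]
      gcongr
  · refine (sq_trilinearForm_le_lconv h₁ h₂ h₃).trans ?_
    gcongr
    refine (lintegral_sq_lconv_le_of_modulation (J₁ := 2 ^ j₁) (J₂ := 2 ^ j₂) (by positivity)
      (by positivity) h₁ h₂ (fun x hx => modulation_le_of_mem_kpRegionTop (s₁ x hx))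
      (fun x hx => modulation_le_of_mem_kpRegionTop (s₂ x hx))).trans ?_
    gcongr
    rw [le_div_iff₀ (by positivity)]
    have hπ := Real.pi_lt_d2
    have hsum : (2 : ℝ) ^ j₃ + 2 ^ (k₁ + k₂ + k₃) ≤ 1025 * 2 ^ j₃ := by linarith
    calc _ ≤ 256 * 3.15 * 2 ^ j₁ * 2 ^ j₂ * (1025 * (2 : ℝ) ^ j₃) := by gcongr
      _ = 256 * 3.15 * 1025 * (2 ^ j₁ * 2 ^ j₂ * 2 ^ j₃) := by ring
      _ ≤ _ := by gcongr; norm_num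

/-- The trilinear estimate behind the unweighted bilinear bound. -/
theorem sq_trilinearForm_le_of_modulation {k₁ k₂ k₃ : ℤ} {j₁ j₂ j₃ : ℕ}
    {F₁ F₂ F₃ : ℝ × ℝ × ℝ → ℝ≥0∞} (h₁ : Measurable F₁) (h₂ : Measurable F₂) (h₃ : Measurable F₃)
    (s₁ : ∀ x, F₁ x ≠ 0 → x ∈ kpRegionTop k₁ j₁) (s₂ : ∀ x, F₂ x ≠ 0 → x ∈ kpRegionTop k₂ j₂)
    (s₃ : ∀ x, F₃ x ≠ 0 → x ∈ kpRegionTop k₃ j₃) :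
    trilinearForm F₁ F₂ F₃ ^ 2 ≤
      ENNReal.ofReal (10 ^ 6 * (2 ^ j₁ * 2 ^ j₂ * 2 ^ j₃) /
        (2 ^ max j₁ (max j₂ j₃) + 2 ^ (k₁ + k₂ + k₃))) *
        (∫⁻ x, F₁ x ^ 2) * (∫⁻ x, F₂ x ^ 2) * ∫⁻ x, F₃ x ^ 2 := by
  rcases le_total j₁ j₃ with h13 | h13 <;> rcases le_total j₂ j₃ with h23 | h23
  · rw [max_eq_right h23, max_eq_right h13]
    exact sq_trilinearForm_le_of_max_third h₁ h₂ h₃ s₁ s₂ s₃ h13 h23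
  · rw [max_eq_left h23, max_eq_right (h13.trans h23), trilinearForm_swap_right]
    refine (sq_trilinearForm_le_of_max_third h₁ h₃ h₂ s₁ s₃ s₂ (h13.trans h23) h23).trans_eq ?_
    rw [add_right_comm, mul_right_comm ((2 : ℝ) ^ j₁), mul_right_comm (ENNReal.ofReal _ * _)]
  · rw [max_eq_right h23, max_eq_left h13, trilinearForm_swap_left h₁ h₂ h₃,
      trilinearForm_swap_right]
    refine (sq_trilinearForm_le_of_max_third h₂ h₃ h₁ s₂ s₃ s₁ (h23.trans h13) h13).trans_eq ?_
    rw [show k₂ + k₃ + k₁ = k₁ + k₂ + k₃ by ring,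
      show (2 : ℝ) ^ j₂ * 2 ^ j₃ * 2 ^ j₁ = 2 ^ j₁ * 2 ^ j₂ * 2 ^ j₃ by ring]
    ring
  · rcases le_total j₁ j₂ with h12 | h12
    · rw [max_eq_left h23, max_eq_right h12, trilinearForm_swap_right]
      refine (sq_trilinearForm_le_of_max_third h₁ h₃ h₂ s₁ s₃ s₂ h12 h23).trans_eq ?_
      rw [add_right_comm, mul_right_comm ((2 : ℝ) ^ j₁), mul_right_comm (ENNReal.ofReal _ * _)]
    · rw [max_eq_left h23, max_eq_left h12, trilinearForm_swap_left h₁ h₂ h₃,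
        trilinearForm_swap_right]
      refine (sq_trilinearForm_le_of_max_third h₂ h₃ h₁ s₂ s₃ s₁ h12 h13).trans_eq ?_
      rw [show k₂ + k₃ + k₁ = k₁ + k₂ + k₃ by ring,
        show (2 : ℝ) ^ j₂ * 2 ^ j₃ * 2 ^ j₁ = 2 ^ j₁ * 2 ^ j₂ * 2 ^ j₃ by ring]
      ring

/-! ### From trilinear bounds to the convolution estimates -/

theorem sq_eLpNorm_two {α E : Type*} [MeasurableSpace α] {μ : Measure α} [NormedAddCommGroup E]
    (f : α → E) : eLpNorm f 2 μ ^ 2 = ∫⁻ x, ‖f x‖ₑ ^ 2 ∂μ := by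
  rw [eLpNorm_eq_lintegral_rpow_enorm_toReal two_ne_zero ENNReal.ofNat_ne_top]
  simp only [ENNReal.toReal_ofNat, ENNReal.rpow_ofNat]
  exact ENNReal.sqrt_sq _

/-- A measurable, everywhere supported representative of the modulus. -/
theorem exists_measurable_enorm_eq {f : ℝ × ℝ × ℝ → ℝ} {k : ℤ} {j : ℕ}
    (hf : IsNonnegL2SupportedIn f (kpRegionTop k j)) :
    ∃ F : ℝ × ℝ × ℝ → ℝ≥0∞, Measurable F ∧ (∀ x, F x ≠ 0 → x ∈ kpRegionTop k j) ∧
      F =ᵐ[volume] fun x => ‖f x‖ₑ := by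
  obtain ⟨hL, -, hs⟩ := hf
  refine ⟨(kpRegionTop k j).indicator fun x => ‖hL.1.mk f x‖ₑ,
    hL.1.stronglyMeasurable_mk.measurable.enorm.indicator (measurableSet_kpRegionTop k j),
    fun x hx => Set.mem_of_indicator_ne_zero hx, ?_⟩
  filter_upwards [hs, hL.1.ae_eq_mk] with x hx hmk
  by_cases h : x ∈ kpRegionTop k j
  · rw [Set.indicator_of_mem h, hmk]
  · rw [Set.indicator_of_notMem h, hx h, enorm_zero]

/-- Here `n` will be the plain or the weighted norm of `f₁`. The latter may be infinite, so the
finiteness required by duality is taken from the Strichartz estimate. -/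
theorem restrictedConvNorm_le {k₁ k₂ k : ℤ} {j₁ j₂ j : ℕ} {f₁ f₂ : ℝ × ℝ × ℝ → ℝ}
    (hf₁ : IsNonnegL2SupportedIn f₁ (kpRegionTop k₁ j₁))
    (hf₂ : IsNonnegL2SupportedIn f₂ (kpRegionTop k₂ j₂)) {c n : ℝ≥0∞}
    (H : ∀ F₁ F₂ F₃ : ℝ × ℝ × ℝ → ℝ≥0∞, Measurable F₁ → Measurable F₂ → Measurable F₃ →
      (∀ x, F₁ x ≠ 0 → x ∈ kpRegionTop k₁ j₁) → (∀ x, F₂ x ≠ 0 → x ∈ kpRegionTop k₂ j₂) →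
      (∀ x, F₃ x ≠ 0 → x ∈ kpRegionTop k j) → F₁ =ᵐ[volume] (fun x => ‖f₁ x‖ₑ) →
      trilinearForm F₁ F₂ F₃ ^ 2 ≤ c ^ 2 * n ^ 2 * (∫⁻ x, F₂ x ^ 2) * ∫⁻ x, F₃ x ^ 2) :
    restrictedConvNorm (kpRegionTop k j) f₁ f₂ ≤ c * n * eLpNorm f₂ 2 volume := by
  obtain ⟨F₁, m₁, s₁, e₁⟩ := exists_measurable_enorm_eq hf₁
  obtain ⟨F₂, m₂, s₂, e₂⟩ := exists_measurable_enorm_eq hf₂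
  have N₁ : ∫⁻ x, F₁ x ^ 2 = eLpNorm f₁ 2 volume ^ 2 := by
    rw [sq_eLpNorm_two]
    exact lintegral_congr_ae (e₁.mono fun x hx => by simp only [hx])
  have N₂ : ∫⁻ x, F₂ x ^ 2 = eLpNorm f₂ 2 volume ^ 2 := by
    rw [sq_eLpNorm_two]
    exact lintegral_congr_ae (e₂.mono fun x hx => by simp only [hx])
  have hfin : ∫⁻ x, lconv F₁ F₂ x ^ 2 ≠ ∞ := by
    refine ne_top_of_le_ne_top ?_ (lintegral_sq_lconv_le_of_modulation (J₁ := 2 ^ j₁)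
      (J₂ := 2 ^ j₂) (by positivity) (by positivity) m₁ m₂ (fun x hx => modulation_le_of_mem_kpRegionTop (s₁ x hx))
      (fun x hx => modulation_le_of_mem_kpRegionTop (s₂ x hx)))
    rw [N₁, N₂]
    exact ENNReal.mul_ne_top (ENNReal.mul_ne_top ENNReal.ofReal_ne_top
      (ENNReal.pow_ne_top hf₁.1.2.ne)) (ENNReal.pow_ne_top hf₂.1.2.ne)
  have hdual := lintegral_sq_lconv_le_of_dual m₁ m₂ (K := c ^ 2 * n ^ 2 * ∫⁻ x, F₂ x ^ 2)
    (measurableSet_kpRegionTop k j) (fun x => neg_mem_kpRegionTop) hfin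
    (fun F₃ m₃ s₃ => H F₁ F₂ F₃ m₁ m₂ m₃ s₁ s₂ s₃ e₁)
  -- True at every point: where the convolution integral does not converge absolutely, its value is
  -- 0.
  have hconv : ∀ x, ‖(f₁ ⋆[ContinuousLinearMap.mul ℝ ℝ, volume] f₂) x‖ₑ ≤ lconv F₁ F₂ x := by
    intro x
    refine (enorm_integral_le_lintegral_enorm _).trans_eq (lintegral_congr_ae ?_)
    have e₂' : ∀ᵐ t, F₂ (x - t) = ‖f₂ (x - t)‖ₑ :=
      (quasiMeasurePreserving_sub_left volume x).ae e₂
    filter_upwards [e₁, e₂'] with t ht₁ ht₂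
    rw [ht₁, ht₂, ContinuousLinearMap.mul_apply', enorm_mul]
  have hle : restrictedConvNorm (kpRegionTop k j) f₁ f₂ ^ 2 ≤
      (c * n * eLpNorm f₂ 2 volume) ^ 2 := by
    unfold restrictedConvNorm
    rw [sq_eLpNorm_two, mul_pow, mul_pow, ← N₂]
    refine le_trans (lintegral_mono fun x => ?_) hdual
    refine pow_le_pow_left' ?_ 2
    by_cases h : x ∈ kpRegionTop k j
    · rw [Set.indicator_of_mem h, Set.indicator_of_mem h]
      exact hconv x
    · rw [Set.indicator_of_notMem h, enorm_zero]
      exact zero_le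
  exact (ENNReal.le_sqrt_of_sq_le hle).trans_eq (ENNReal.sq_sqrt _)

/-- The 32 is `2 * 4 * 4`: the lengths in `τ` and `ξ` contribute 2 and 4, and `π < 4`. -/
theorem restrictedConvNorm_le_weighted {k₁ k₂ k : ℤ} {j₁ j₂ j : ℕ} {f₁ f₂ : ℝ × ℝ × ℝ → ℝ}
    (hf₁ : IsNonnegL2SupportedIn f₁ (kpRegionTop k₁ j₁))
    (hf₂ : IsNonnegL2SupportedIn f₂ (kpRegionTop k₂ j₂)) {A c : ℝ} (hc : 0 ≤ c)
    (hA : ∀ ξ ∈ dyadicShell k₁, |ξ| + |ξ| ^ 2 ≤ A)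
    (hAc : 32 * A * 2 ^ min k₁ (min k₂ k) * 2 ^ min j₁ (min j₂ j) ≤ c ^ 2) :
    restrictedConvNorm (kpRegionTop k j) f₁ f₂ ≤ ENNReal.ofReal c *
      eLpNorm (fun x => kpWeight x.1 x.2.1 * f₁ x) 2 volume * eLpNorm f₂ 2 volume := by
  have hA0 : 0 ≤ A := le_trans (by positivity) (hA (2 ^ k₁) (by
    constructor <;> rw [abs_of_pos (by positivity)]
    · exact zpow_le_zpow_right₀ (by norm_num) (by linarith)
    · exact zpow_le_zpow_right₀ (by norm_num) (by linarith)))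
  refine restrictedConvNorm_le hf₁ hf₂ fun F₁ F₂ F₃ m₁ m₂ m₃ s₁ s₂ s₃ e₁ => ?_
  refine (sq_trilinearForm_le_weighted m₁ m₂ m₃ s₁ s₂ s₃ hA).trans ?_
  have hN : ∫⁻ x, (ENNReal.ofReal (kpWeight x.1 x.2.1) * F₁ x) ^ 2 =
      eLpNorm (fun x => kpWeight x.1 x.2.1 * f₁ x) 2 volume ^ 2 := by
    rw [sq_eLpNorm_two]
    refine lintegral_congr_ae (e₁.mono fun x hx => ?_)
    have := one_le_kpWeight x.1 x.2.1
    simp only [hx, enorm_mul]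
    rw [Real.enorm_of_nonneg (show 0 ≤ kpWeight x.1 x.2.1 by linarith)]
  rw [hN]
  gcongr
  rw [← ENNReal.ofReal_mul (by positivity), ← ENNReal.ofReal_mul (by positivity),
    ← ENNReal.ofReal_pow hc]
  refine ENNReal.ofReal_le_ofReal (le_trans ?_ hAc)
  have hπ := Real.pi_lt_four
  calc _ ≤ 2 * 2 ^ min j₁ (min j₂ j) * (4 * A) * (4 * (2 : ℝ) ^ min k₁ (min k₂ k)) := by gcongr
    _ = _ := by ring

theorem abs_add_sq_le_of_mem_dyadicShell {k : ℤ} {ξ : ℝ} (h : ξ ∈ dyadicShell k) :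
    |ξ| + |ξ| ^ 2 ≤ 2 * 2 ^ k + 4 * (2 ^ k) ^ 2 := by
  have h2 := h.2
  rw [zpow_add_one₀ two_ne_zero] at h2
  have h3 : |ξ| ^ 2 ≤ (2 ^ k * 2) ^ 2 := pow_le_pow_left₀ (abs_nonneg _) h2 2
  linarith [h3, show ((2 : ℝ) ^ k * 2) ^ 2 = 4 * (2 ^ k) ^ 2 by ring]

theorem sq_two_rpow_half (s : ℝ) : ((2 : ℝ) ^ (s / 2)) ^ 2 = 2 ^ s := by
  rw [← Real.rpow_natCast, ← Real.rpow_mul (by norm_num)]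
  norm_num

theorem mainTheorem8 :
    (∃ C : ℝ, 0 < C ∧ ∀ (k₁ k₂ k : ℤ) (j₁ j₂ j : ℕ) (f₁ f₂ : ℝ × ℝ × ℝ → ℝ),
      IsNonnegL2SupportedIn f₁ (kpRegionTop k₁ j₁) →
      IsNonnegL2SupportedIn f₂ (kpRegionTop k₂ j₂) →
      restrictedConvNorm (kpRegionTop k j) f₁ f₂ ≤
        ENNReal.ofReal (C * (2 : ℝ) ^ (((j₁ : ℝ) + j₂ + j) / 2) *
          ((2 : ℝ) ^ max j₁ (max j₂ j) + (2 : ℝ) ^ (k₁ + k₂ + k)) ^ (-(1 / 2) : ℝ)) *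
        eLpNorm f₁ 2 volume * eLpNorm f₂ 2 volume) ∧
    (∃ C : ℝ, 0 < C ∧ ∀ (k₁ k₂ k : ℤ) (j₁ j₂ j : ℕ) (f₁ f₂ : ℝ × ℝ × ℝ → ℝ),
      IsNonnegL2SupportedIn f₁ (kpRegionTop k₁ j₁) →
      IsNonnegL2SupportedIn f₂ (kpRegionTop k₂ j₂) →
      k₁ ≤ 100 →
      restrictedConvNorm (kpRegionTop k j) f₁ f₂ ≤
        ENNReal.ofReal (C * (2 : ℝ) ^
          (((k₁ : ℝ) + (min k₁ (min k₂ k) : ℤ) + (min j₁ (min j₂ j) : ℕ)) / 2)) *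
        eLpNorm (fun x => kpWeight x.1 x.2.1 * f₁ x) 2 volume * eLpNorm f₂ 2 volume) ∧
    (∃ C : ℝ, 0 < C ∧ ∀ (k₁ k₂ k : ℤ) (j₁ j₂ j : ℕ) (f₁ f₂ : ℝ × ℝ × ℝ → ℝ),
      IsNonnegL2SupportedIn f₁ (kpRegionTop k₁ j₁) →
      IsNonnegL2SupportedIn f₂ (kpRegionTop k₂ j₂) →
      -100 ≤ k₁ →
      restrictedConvNorm (kpRegionTop k j) f₁ f₂ ≤
        ENNReal.ofReal (C * (2 : ℝ) ^
          ((2 * (k₁ : ℝ) + (min k₁ (min k₂ k) : ℤ) + (min j₁ (min j₂ j) : ℕ)) / 2)) *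
        eLpNorm (fun x => kpWeight x.1 x.2.1 * f₁ x) 2 volume * eLpNorm f₂ 2 volume) := by
  -- 1000 is the square root of the trilinear constant `10 ^ 6`. In the weighted cases `|ξ| + |ξ|² ≤
  -- 2 * 2 ^ k₁ + 4 * (2 ^ k₁)²`, and the bound on `k₁` lets one term absorb the other at the cost
  -- of `2 ^ 103`; then `32 * 2 ^ 103 = 2 ^ 108` is below `(2 ^ 60)²`.
  refine ⟨⟨1000, by norm_num, fun k₁ k₂ k j₁ j₂ j f₁ f₂ hf₁ hf₂ => ?_⟩,
    ⟨2 ^ 60, by norm_num, fun k₁ k₂ k j₁ j₂ j f₁ f₂ hf₁ hf₂ hk => ?_⟩,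
    ⟨2 ^ 60, by norm_num, fun k₁ k₂ k j₁ j₂ j f₁ f₂ hf₁ hf₂ hk => ?_⟩⟩
  · refine restrictedConvNorm_le hf₁ hf₂ fun F₁ F₂ F₃ m₁ m₂ m₃ s₁ s₂ s₃ e₁ => ?_
    refine (sq_trilinearForm_le_of_modulation m₁ m₂ m₃ s₁ s₂ s₃).trans ?_
    have hN : ∫⁻ x, F₁ x ^ 2 = eLpNorm f₁ 2 volume ^ 2 := by
      rw [sq_eLpNorm_two]
      exact lintegral_congr_ae (e₁.mono fun x hx => by simp only [hx])
    rw [hN]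
    gcongr
    rw [← ENNReal.ofReal_pow (by positivity)]
    refine ENNReal.ofReal_le_ofReal (le_of_eq ?_)
    set S : ℝ := (2 : ℝ) ^ max j₁ (max j₂ j) + (2 : ℝ) ^ (k₁ + k₂ + k) with hS
    have pS : 0 < S := by positivity
    have hS2 : (S ^ (-(1 / 2) : ℝ)) ^ 2 = S⁻¹ := by
      rw [← Real.rpow_natCast, ← Real.rpow_mul pS.le, ← Real.rpow_neg_one]
      norm_num
    rw [mul_pow, mul_pow, sq_two_rpow_half, hS2, Real.rpow_add two_pos, Real.rpow_add two_pos,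
      Real.rpow_natCast, Real.rpow_natCast, Real.rpow_natCast, div_eq_mul_inv]
    norm_num
  · refine restrictedConvNorm_le_weighted hf₁ hf₂ (A := 2 ^ 103 * 2 ^ k₁) (by positivity)
      (fun ξ hξ => (abs_add_sq_le_of_mem_dyadicShell hξ).trans ?_) ?_
    · have h : (2 : ℝ) ^ k₁ ≤ 2 ^ (100 : ℤ) := zpow_le_zpow_right₀ (by norm_num) hk
      have h0 : (0 : ℝ) < 2 ^ k₁ := by positivity
      norm_num at h
      nlinarith
    · rw [mul_pow, sq_two_rpow_half, Real.rpow_add two_pos, Real.rpow_add two_pos,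
        Real.rpow_intCast, Real.rpow_intCast, Real.rpow_natCast]
      calc _ = 2 ^ 108 * ((2 : ℝ) ^ k₁ * 2 ^ min k₁ (min k₂ k) * 2 ^ min j₁ (min j₂ j)) := by ring
        _ ≤ _ := by gcongr; norm_num
  · refine restrictedConvNorm_le_weighted hf₁ hf₂ (A := 2 ^ 103 * (2 ^ k₁) ^ 2) (by positivity)
      (fun ξ hξ => (abs_add_sq_le_of_mem_dyadicShell hξ).trans ?_) ?_
    · have h : (2 : ℝ) ^ (-100 : ℤ) ≤ 2 ^ k₁ := zpow_le_zpow_right₀ (by norm_num) hk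
      have h0 : (0 : ℝ) < 2 ^ k₁ := by positivity
      norm_num at h
      nlinarith
    · rw [mul_pow, sq_two_rpow_half, Real.rpow_add two_pos, Real.rpow_add two_pos, two_mul,
        Real.rpow_add two_pos, Real.rpow_intCast, Real.rpow_intCast, Real.rpow_natCast]
      calc _ = 2 ^ 108 *
            ((2 : ℝ) ^ k₁ * 2 ^ k₁ * 2 ^ min k₁ (min k₂ k) * 2 ^ min j₁ (min j₂ j)) := by ring
        _ ≤ _ := by gcongr; norm_num
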